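/- For every integer $D\ge 2$ there are constants $c_0=c_0(D)>0$ and $c_1=c_1(D)>0$ such that (1) and (2) below hold. Definitions. An embedding of $n$ qubits in $\mathbb{R}^D$ assigns to each qubit a point of $\mathbb{R}^D$ so that any two distinct qubits are at Euclidean distance at least $1$. An $[[n,k,d]]$ subsystem code with $g$ gauge qubits is given by an abelian subgroup $\mathcal S\not\ni -I$ of the $n$-qubit Pauli group with $n-k-g$ independent generators, and by logical Pauli operators $\bar X_1,\bar Z_1,\dots,\bar X_{k+g},\bar Z_{k+g}$ that commute with $\mathcal S$ and satisfy the Pauli commutation relations. Its gauge group $\mathcal G$ is generated by $\mathcal S$, the operators $\bar X_i,\bar Z_i$ with $i>k$, and the phases. Its distance $d$ is the least weight of an element of $\mathsf C(\mathcal S)\setminus\mathcal G$, where $\mathsf C(\mathcal S)$ is the centralizer of $\mathcal S$ in the Pauli group. A commuting projector code is the space of vectors of $(\mathbb{C}^2)^{\otimes n}$ fixed by finitely many pairwise commuting orthogonal projections $\Pi_1,\dots,\Pi_m$. Its dimension is $k=\log_2$ of the dimension of this space, and its distance $d$ is the least weight of a Pauli operator whose compression to this space is not a multiple of the identity. A code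 is nontrivial if $k>0$. Given a finite family of Pauli operators that generates $\mathcal G$ up to phases (for a commuting projector code: given the defining projections), an interaction is an unordered pair of distinct qubits that both lie in the support of one member of the family. Its length is the distance between the two embedded qubits. (1) Let a nontrivial $[[n,k,d]]$ subsystem code, with any fixed family of gauge generators, be embedded in $\mathbb{R}^D$, and suppose that $k\,d^{\frac1{D-1}}\ge c_1 n$ or $d\ge c_1 n^{\frac{D-1}{D}}$. Then it has at least $c_0\max(k,d)$ interactions of length at least $$c_0\max\left(\frac{d}{n^{\frac{D-1}{D}}},\ \left(\frac{k\,d^{\frac1{D-1}}}{n}\right)^{\frac{D-1}{D}}\right).$$ (2) Let a nontrivial $[[n,k,d]]$ commuting projector code be embedded in $\mathbb{R}^D$, and suppose that $d\ge c_1 n^{\frac{D-1}{D}}$. Then it has at least $c_0 d$ interactions of length at least $c_0\, d/n^{\frac{D-1}{D}}$. -/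

import Mathlib

noncomputable section

/-- Operators on `(ℂ²)^{⊗ n}`, as matrices in the computational basis, which is indexed by the
bit strings `Fin n → Fin 2`. -/
abbrev QOp (n : ℕ) : Type := Matrix (Fin n → Fin 2) (Fin n → Fin 2) ℂ

/-- The tensor product `A₀ ⊗ ⋯ ⊗ Aₙ₋₁` of one-qubit operators. -/
def qTensor {n : ℕ} (A : Fin n → Matrix (Fin 2) (Fin 2) ℂ) : QOp n :=
  Matrix.of fun x y => ∏ j, A j (x j) (y j)

/-- The four one-qubit Pauli matrices `I, X, Y, Z`. -/
def pauliMat : Fin 4 → Matrix (Fin 2) (Fin 2) ℂ :=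
  ![1, !![0, 1; 1, 0], !![0, -Complex.I; Complex.I, 0], !![1, 0; 0, -1]]

theorem qTensor_mul {n : ℕ} (A B : Fin n → Matrix (Fin 2) (Fin 2) ℂ) :
    qTensor A * qTensor B = qTensor fun j => A j * B j := by
  ext x y
  simp only [qTensor, Matrix.mul_apply, Matrix.of_apply, ← Finset.prod_mul_distrib]
  rw [Finset.prod_univ_sum, Fintype.piFinset_univ]

theorem qTensor_one {n : ℕ} : qTensor (fun _ : Fin n => (1 : Matrix (Fin 2) (Fin 2) ℂ)) = 1 := by
  ext x y
  simp only [qTensor, Matrix.of_apply, Matrix.one_apply]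
  by_cases h : x = y
  · simp [h]
  · obtain ⟨j, hj⟩ := Function.ne_iff.mp h
    rw [if_neg h]
    exact Finset.prod_eq_zero (Finset.mem_univ j) (by simp [hj])

theorem qTensor_smul {n : ℕ} (a : Fin n → ℂ) (A : Fin n → Matrix (Fin 2) (Fin 2) ℂ) :
    qTensor (fun j => a j • A j) = (∏ j, a j) • qTensor A := by
  ext x y
  simp [qTensor, Finset.prod_mul_distrib]

theorem pauliMat_sq (a : Fin 4) : pauliMat a * pauliMat a = 1 := by
  fin_cases a <;> ext i j <;> fin_cases i <;> fin_cases j <;>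
    simp [pauliMat, Matrix.mul_apply, Fin.sum_univ_two]

theorem pauliMat_mul (a b : Fin 4) :
    ∃ (c : ℕ) (e : Fin 4), pauliMat a * pauliMat b = Complex.I ^ c • pauliMat e := by
  have h3 : Complex.I ^ 3 = -Complex.I := Complex.I_pow_three
  fin_cases a <;> fin_cases b
  · exact ⟨0, 0, by simp [pauliMat]⟩
  · exact ⟨0, 1, by simp [pauliMat]⟩
  · exact ⟨0, 2, by simp [pauliMat]⟩
  · exact ⟨0, 3, by simp [pauliMat]⟩
  · exact ⟨0, 1, by simp [pauliMat]⟩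
  · exact ⟨0, 0, by simpa [pauliMat] using pauliMat_sq 1⟩
  · exact ⟨1, 3, by ext i j; fin_cases i <;> fin_cases j <;> simp [pauliMat]⟩
  · exact ⟨3, 2, by ext i j; fin_cases i <;> fin_cases j <;> simp [pauliMat, h3]⟩
  · exact ⟨0, 2, by simp [pauliMat]⟩
  · exact ⟨3, 3, by ext i j; fin_cases i <;> fin_cases j <;> simp [pauliMat, h3]⟩
  · exact ⟨0, 0, by simpa [pauliMat] using pauliMat_sq 2⟩
  · exact ⟨1, 1, by ext i j; fin_cases i <;> fin_cases j <;> simp [pauliMat]⟩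
  · exact ⟨0, 3, by simp [pauliMat]⟩
  · exact ⟨1, 2, by ext i j; fin_cases i <;> fin_cases j <;> simp [pauliMat]⟩
  · exact ⟨3, 1, by ext i j; fin_cases i <;> fin_cases j <;> simp [pauliMat, h3]⟩
  · exact ⟨0, 0, by simpa [pauliMat] using pauliMat_sq 3⟩

/-- The `n`-qubit Pauli group: tensor products of Pauli matrices times a power of `i`. -/
def pauliGroup (n : ℕ) : Subgroup (QOp n)ˣ where
  carrier := {P | ∃ (c : ℕ) (s : Fin n → Fin 4),
    (P : QOp n) = Complex.I ^ c • qTensor fun j => pauliMat (s j)}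
  one_mem' := ⟨0, fun _ => 0, by simpa [pauliMat] using (qTensor_one (n := n)).symm⟩
  mul_mem' := by
    rintro P R ⟨c, s, hP⟩ ⟨c', s', hR⟩
    choose e t h using fun j => pauliMat_mul (s j) (s' j)
    refine ⟨c + c' + ∑ j, e j, t, ?_⟩
    rw [Units.val_mul, hP, hR, smul_mul_smul_comm, qTensor_mul, funext h, qTensor_smul,
      Finset.prod_pow_eq_pow_sum, smul_smul, ← pow_add, ← pow_add]
  inv_mem' := by
    rintro P ⟨c, s, hP⟩
    refine ⟨3 * c, s, ?_⟩
    refine Units.inv_eq_of_mul_eq_one_right ?_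
    rw [hP, smul_mul_smul_comm, qTensor_mul]
    simp only [pauliMat_sq]
    rw [qTensor_one, ← pow_add, show c + 3 * c = 4 * c by ring, pow_mul, Complex.I_pow_four,
      one_pow, one_smul]

/-- An element of the `n`-qubit Pauli group. -/
abbrev PauliOp (n : ℕ) : Type := pauliGroup n

/-- The operator on `(ℂ²)^{⊗ n}` given by an element of the Pauli group. -/
def PauliOp.toOp {n : ℕ} (P : PauliOp n) : QOp n := ((P : (QOp n)ˣ) : QOp n)

/-- The elements of the Pauli group that are multiples of the identity. -/
def pauliPhases (n : ℕ) : Subgroup (PauliOp n) where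
  carrier := {P | ∃ c : ℂ, P.toOp = c • (1 : QOp n)}
  one_mem' := ⟨1, by simp [PauliOp.toOp]⟩
  mul_mem' := by
    rintro P R ⟨c, hP⟩ ⟨c', hR⟩
    refine ⟨c * c', ?_⟩
    have h : (P * R).toOp = P.toOp * R.toOp := rfl
    rw [h, hP, hR, smul_mul_smul_comm, one_mul]
  inv_mem' := by
    rintro P ⟨c, hP⟩
    have h : P⁻¹.toOp * P.toOp = 1 := (P : (QOp n)ˣ).inv_mul
    have h' : P.toOp * P⁻¹.toOp = 1 := (P : (QOp n)ˣ).mul_inv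
    rw [hP] at h h'
    have hc : c ≠ 0 := by
      rintro rfl
      simp at h
    refine ⟨c⁻¹, ?_⟩
    rw [smul_mul_assoc, one_mul] at h'
    rw [← h', smul_smul, inv_mul_cancel₀ hc, one_smul]

/-- `M` acts trivially on the qubit `q`: it is the tensor product of the identity on `q` with an
operator on the other qubits. -/
def ActsTriviallyOn {n : ℕ} (M : QOp n) (q : Fin n) : Prop :=
  ∀ x y, M x y = if x q = y q then M (Function.update x q 0) (Function.update y q 0) else 0

/-- The support of an operator: the qubits on which it acts nontrivially. -/
def opSupport {n : ℕ} (M : QOp n) : Set (Fin n) := {q | ¬ ActsTriviallyOn M q}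

/-- The weight of a Pauli operator: the number of its tensor components other than `I`. -/
def PauliOp.weight {n : ℕ} (P : PauliOp n) : ℕ := (opSupport P.toOp).ncard

/-- A subsystem code on `n` physical qubits with `k` logical qubits and `g` gauge qubits:
a stabilizer group with `n - k - g` independent generators, together with logical operators
`X̄ i, Z̄ i` of the `k + g` encoded qubits, of which the first `k` hold the information and the last
`g` are the gauge qubits. -/
structure SubsystemCode (n k g : ℕ) where
  rank : ℕ
  rank_add : rank + k + g = n
  stab : Fin rank → PauliOp n
  stab_comm : ∀ i j, Commute (stab i) (stab j)
  stab_indep : ∀ i, stab i ∉ Subgroup.closure (stab '' {j | j ≠ i})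
  neg_one_notMem : ∀ P ∈ Subgroup.closure (Set.range stab), P.toOp ≠ -1
  logX : Fin (k + g) → PauliOp n
  logZ : Fin (k + g) → PauliOp n
  logX_stab : ∀ i j, Commute (logX i) (stab j)
  logZ_stab : ∀ i j, Commute (logZ i) (stab j)
  logX_comm : ∀ i j, Commute (logX i) (logX j)
  logZ_comm : ∀ i j, Commute (logZ i) (logZ j)
  logX_logZ_comm : ∀ i j, i ≠ j → Commute (logX i) (logZ j)
  logX_logZ_anticomm : ∀ i, (logX i * logZ i).toOp = -(logZ i * logX i).toOp

namespace SubsystemCode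

variable {n k g : ℕ}

/-- The stabilizer group. -/
def stabilizerGroup (C : SubsystemCode n k g) : Subgroup (PauliOp n) :=
  Subgroup.closure (Set.range C.stab)

/-- The gauge group, generated by the stabilizers and the logical operators of the gauge qubits.
Operators that differ by a phase are not distinguished, so the phases are included. -/
def gaugeGroup (C : SubsystemCode n k g) : Subgroup (PauliOp n) :=
  C.stabilizerGroup ⊔
    Subgroup.closure (Set.range fun j : Fin g => C.logX (Fin.natAdd k j)) ⊔
    Subgroup.closure (Set.range fun j : Fin g => C.logZ (Fin.natAdd k j)) ⊔ pauliPhases n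

/-- Nontrivial dressed logical operators: they commute with the stabilizer group and do not
belong to the gauge group. -/
def IsDressedLogical (C : SubsystemCode n k g) (P : PauliOp n) : Prop :=
  P ∈ Subgroup.centralizer (C.stabilizerGroup : Set (PauliOp n)) ∧ P ∉ C.gaugeGroup

/-- The distance is `d`: the least weight of a nontrivial dressed logical operator. -/
def HasDistance (C : SubsystemCode n k g) (d : ℕ) : Prop :=
  IsLeast {w | ∃ P, C.IsDressedLogical P ∧ P.weight = w} d

/-- `G 0, …, G (m - 1)` are gauge generators: they generate the gauge group, up to phases. -/
def IsGaugeGenerators (C : SubsystemCode n k g) {m : ℕ} (G : Fin m → PauliOp n) : Prop :=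
  Subgroup.closure (Set.range G) ⊔ pauliPhases n = C.gaugeGroup

end SubsystemCode

/-- A commuting projector code on `n` qubits, given by `m` pairwise commuting orthogonal
projections. -/
structure CommutingProjectorCode (n m : ℕ) where
  proj : Fin m → QOp n
  proj_hermitian : ∀ i, (proj i).IsHermitian
  proj_idem : ∀ i, proj i * proj i = proj i
  proj_comm : ∀ i j, Commute (proj i) (proj j)

namespace CommutingProjectorCode

variable {n m : ℕ}

/-- The code space: the states left invariant by all the projections. -/
def codeSpace (C : CommutingProjectorCode n m) : Submodule ℂ ((Fin n → Fin 2) → ℂ) where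
  carrier := {ψ | ∀ i, (C.proj i).mulVec ψ = ψ}
  add_mem' := by
    intro a b ha hb i
    rw [Matrix.mulVec_add, ha i, hb i]
  zero_mem' := fun i => Matrix.mulVec_zero _
  smul_mem' := by
    intro c a ha i
    rw [Matrix.mulVec_smul, ha i]

/-- The dimension `k = log₂ dim` of the code. -/
def dimension (C : CommutingProjectorCode n m) : ℝ :=
  Real.logb 2 (Module.finrank ℂ C.codeSpace)

/-- A Pauli error acts nontrivially on the code in an undetectable way: compressed to the code
space, it is not a multiple of the identity. -/
def IsLogicalError (C : CommutingProjectorCode n m) (E : PauliOp n) : Prop :=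
  ¬ ∃ c : ℂ, ∀ φ ∈ C.codeSpace, ∀ ψ ∈ C.codeSpace,
    dotProduct (star φ) (E.toOp.mulVec ψ) = c * dotProduct (star φ) ψ

/-- The distance is `d`: the least weight of an undetectable error. -/
def HasDistance (C : CommutingProjectorCode n m) (d : ℕ) : Prop :=
  IsLeast {w | ∃ E : PauliOp n, C.IsLogicalError E ∧ E.weight = w} d

end CommutingProjectorCode

/-- An embedding of `n` qubits into `ℝ^D`: any two qubits are at Euclidean distance at least 1. -/
def IsQubitEmbedding {n D : ℕ} (ι : Fin n → EuclideanSpace ℝ (Fin D)) : Prop :=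
  ∀ p q, p ≠ q → 1 ≤ dist (ι p) (ι q)

/-- The interactions of length at least `ℓ`: unordered pairs `{p, q}` of qubits, written with
`p < q`, that lie in the support of a common generator and are at distance at least `ℓ`. -/
def longInteractions {n D : ℕ} (gens : Set (QOp n)) (ι : Fin n → EuclideanSpace ℝ (Fin D))
    (ℓ : ℝ) : Set (Fin n × Fin n) :=
  {e | e.1 < e.2 ∧ (∃ M ∈ gens, e.1 ∈ opSupport M ∧ e.2 ∈ opSupport M) ∧
    ℓ ≤ dist (ι e.1) (ι e.2)}

end

/-!
The proof is by contradiction, through the notion of a correctable set of qubits.  A set of fewer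
than `d` qubits is correctable; decoupled correctable sets are correctable together; and a
correctable set may be enlarged by a correctable set that contains its neighbours in the interaction
graph.  For a subsystem code there are two notions, bare and dressed, and these rules are symplectic
linear algebra over `ℤ/2`: the second holds because a bare operator on decoupled sets is a product of
bare operators, the third by the cleaning lemma (`sympPerp_le_of_dressed`).  For a commuting
projector code correctability is the Knill–Laflamme condition; the second rule
(`KnillLaflamme.union`) is a computation with the projections that meet one of the two sets, and the
third (`KnillLaflamme.union_of_boundary`) rests on an explicit representative of each logical
operator off an erased set (`IsCodeProjection.exists_recovery`).  The structure `CorrectableSets`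
collects the rules, so that the geometry is done once.

Let `K = max k d` (`K = d` for commuting projectors) and suppose that fewer than `c₀ K` interactions
have length at least `ℓ`, with endpoints `S`.  In the lattice of cells of side `ℓ` the qubits off `S`
interact only with qubits of the same or an adjacent cell.  A cube of cells that contains few qubits
of `S` is correctable, since it can be grown from its centre by layers of fewer than `d` qubits
(`dressed_cellCube`).  Cutting space into cubes of this size, and halving repeatedly those with many
qubits of `S`, shows that all qubits but those of a set `B` form a bare correctable set
(`exists_bare_compl`), and the choice of `ℓ` gives `|B| < K` (`exists_bare_compl_card_lt`).

If a set is bare correctable in a subsystem code, then all `2 k` independent logical operators can be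
moved to its complement by gauge operators, so the complement has at least `k` qubits
(`SubsystemCode.dim_le_card_compl`).  If `K = k`, this contradicts `|B| < k`.  If `K = d`, then `B`
is correctable as well, hence so is the set of all qubits.  For a subsystem code this gives `k ≤ 0`;
for a commuting projector code the operator that attains the distance contradicts it.
-/

/-! ### Correctable sets of an interaction graph -/

/-- The two notions of correctability of a set of qubits that drive the argument, together with
the rules by which correctable sets are enlarged.  Here `adj` is the interaction graph and `d` is
the distance.  For a subsystem code `Bare A` says that `A` supports no nontrivial bare logical
operator, and `Dressed A` that it supports no nontrivial dressed one; for a commuting projector code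
both say that the erasure of `A` can be corrected. -/
structure CorrectableSets {V : Type*} [DecidableEq V] (adj : V → V → Prop) (d : ℕ) where
  Bare : Finset V → Prop
  Dressed : Finset V → Prop
  pos : 0 < d
  bare_mono : ∀ {A B}, A ⊆ B → Bare B → Bare A
  bare_of_dressed : ∀ {A}, Dressed A → Bare A
  dressed_of_card_lt : ∀ {A}, A.card < d → Dressed A
  bare_union : ∀ {A B}, Bare A → Bare B → Disjoint A B → (∀ a ∈ A, ∀ b ∈ B, ¬ adj a b) →
    Bare (A ∪ B)
  dressed_union : ∀ {W T}, Bare W → Dressed T → Disjoint W T →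
    (∀ w ∈ W, ∀ v, v ∉ W ∪ T → ¬ adj w v) → Dressed (W ∪ T)

namespace CorrectableSets

variable {V : Type*} [DecidableEq V] {adj : V → V → Prop} {d : ℕ}

theorem bare_of_label (C : CorrectableSets adj d) {α : Type*} [DecidableEq α] (f : V → α)
    (A : Finset V) (h : ∀ a, C.Bare (A.filter (f · = a)))
    (hadj : ∀ u ∈ A, ∀ v ∈ A, f u ≠ f v → ¬ adj u v) : C.Bare A := by
  have key : ∀ s : Finset α, C.Bare (A.filter (f · ∈ s)) := by
    intro s
    induction s using Finset.induction_on with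
    | empty => exact C.bare_of_dressed (C.dressed_of_card_lt (by simpa using C.pos))
    | insert a s ha ih =>
      have e : A.filter (f · ∈ insert a s) = A.filter (f · = a) ∪ A.filter (f · ∈ s) := by
        ext v; simp only [Finset.mem_filter, Finset.mem_insert, Finset.mem_union]; tauto
      rw [e]
      refine C.bare_union (h a) ih ?_ ?_
      · rw [Finset.disjoint_filter]
        rintro v - rfl hv
        exact ha hv
      · intro u hu v hv
        rw [Finset.mem_filter] at hu hv
        refine hadj u hu.1 v hv.1 ?_
        rintro e
        exact ha (hu.2 ▸ e ▸ hv.2)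
  have := key (A.image f)
  rwa [Finset.filter_true_of_mem fun v hv => Finset.mem_image_of_mem f hv] at this

end CorrectableSets

/-! ### Cubes of lattice cells -/

section Cells

variable {V : Type*} [Fintype V] {D : ℕ}

/-- The vertices whose cell `z v` lies in the cube with lowest corner `c` and side `m`, at depth at
least `a` inside that cube. -/
def cellCube (z : V → Fin D → ℤ) (c : Fin D → ℤ) (m a : ℕ) : Finset V :=
  Finset.univ.filter fun v => ∀ i, c i + a ≤ z v i ∧ z v i < c i + m - a

/-- The vertices whose cell lies in a cube of side `m` and on the hyperplane where coordinate `i`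
equals `t`. -/
def cellSlab (z : V → Fin D → ℤ) (c : Fin D → ℤ) (m : ℕ) (i : Fin D) (t : ℤ) : Finset V :=
  Finset.univ.filter fun v => (∀ j, c j ≤ z v j ∧ z v j < c j + m) ∧ z v i = t

theorem mem_cellCube {z : V → Fin D → ℤ} {c : Fin D → ℤ} {m a : ℕ} {v : V} :
    v ∈ cellCube z c m a ↔ ∀ i, c i + a ≤ z v i ∧ z v i < c i + m - a := by
  simp [cellCube]

theorem mem_cellSlab {z : V → Fin D → ℤ} {c : Fin D → ℤ} {m : ℕ} {i : Fin D} {t : ℤ} {v : V} :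
    v ∈ cellSlab z c m i t ↔ (∀ j, c j ≤ z v j ∧ z v j < c j + m) ∧ z v i = t := by
  simp [cellSlab]

theorem card_cellSlab_le {z : V → Fin D → ℤ} {κ : ℕ}
    (hκ : ∀ c, (Finset.univ.filter fun v => z v = c).card ≤ κ)
    (c : Fin D → ℤ) (m : ℕ) (i : Fin D) (t : ℤ) :
    (cellSlab z c m i t).card ≤ κ * m ^ (D - 1) := by
  set P : Finset (Fin D → ℤ) :=
    Fintype.piFinset (Function.update (fun j => Finset.Ico (c j) (c j + m)) i {t}) with hP
  have hcard : P.card = m ^ (D - 1) := by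
    rw [hP, Fintype.card_piFinset, ← Finset.mul_prod_erase _ _ (Finset.mem_univ i),
      Function.update_self, Finset.card_singleton, one_mul,
      Finset.prod_congr rfl (g := fun _ => m), Finset.prod_const,
      Finset.card_erase_of_mem (Finset.mem_univ i), Finset.card_univ, Fintype.card_fin]
    intro j hj
    rw [Function.update_of_ne (Finset.ne_of_mem_erase hj), Int.card_Ico]
    simp
  rw [← hcard]
  refine Finset.card_le_mul_card_image_of_maps_to (f := z) ?_ κ ?_
  · intro v hv
    obtain ⟨h, ht⟩ := mem_cellSlab.1 hv
    rw [hP, Fintype.mem_piFinset]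
    intro j
    by_cases hj : j = i
    · subst hj; simp [ht]
    · rw [Function.update_of_ne hj]; exact Finset.mem_Ico.2 (h j)
  · intro b _
    exact (Finset.card_le_card (Finset.filter_subset_filter _ (Finset.subset_univ _))).trans (hκ b)

variable [DecidableEq V] {adj : V → V → Prop} {d : ℕ}

/-- A cube with few bad vertices is correctable: it is grown from its centre in layers that are one
cell thick, and each layer, together with the bad vertices of the cube, has fewer than `d`
vertices. -/
theorem dressed_cellCube (C : CorrectableSets adj d) (hD : 0 < D) {z : V → Fin D → ℤ} {κ : ℕ}
    (hκ : ∀ c, (Finset.univ.filter fun v => z v = c).card ≤ κ) {S : Finset V}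
    (hS : ∀ u v, adj u v → u ∉ S → ∀ i, |z u i - z v i| ≤ 1)
    (c : Fin D → ℤ) (m : ℕ) (hm : 8 * D * κ * m ^ (D - 1) ≤ d)
    (hs : 4 * (S ∩ cellCube z c m 0).card ≤ d) : C.Dressed (cellCube z c m 0) := by
  have key : ∀ j a : ℕ, m ≤ a + j → C.Dressed (cellCube z c m a) := by
    intro j
    induction j with
    | zero =>
      intro a ha
      refine C.dressed_of_card_lt ?_
      have : cellCube z c m a = ∅ := by
        refine Finset.eq_empty_of_forall_notMem fun v hv => ?_
        have := mem_cellCube.1 hv ⟨0, hD⟩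
        omega
      rw [this]; exact C.pos
    | succ j ih =>
      intro a ha
      have h1 := ih (a + 1) (by omega)
      set W := cellCube z c m (a + 1) \ S with hW
      set T := cellCube z c m a \ W with hT
      have hsub : cellCube z c m (a + 1) ⊆ cellCube z c m a := by
        intro v hv
        rw [mem_cellCube] at hv ⊢
        intro i
        have := hv i
        push_cast at this
        omega
      have hWT : W ∪ T = cellCube z c m a :=
        Finset.union_sdiff_of_subset (Finset.sdiff_subset.trans hsub)
      have hWb : C.Bare W := C.bare_mono Finset.sdiff_subset (C.bare_of_dressed h1)
      have hTsub : T ⊆ (S ∩ cellCube z c m 0) ∪ Finset.univ.biUnion fun i =>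
          cellSlab z c m i (c i + a) ∪ cellSlab z c m i (c i + m - a - 1) := by
        intro v hv
        rw [hT, hW, Finset.mem_sdiff, Finset.mem_sdiff] at hv
        obtain ⟨hv1, hv2⟩ := hv
        have hv1' := mem_cellCube.1 hv1
        rw [Finset.mem_union, Finset.mem_inter]
        by_cases hvS : v ∈ S
        · left
          refine ⟨hvS, mem_cellCube.2 fun i => ?_⟩
          have := hv1' i
          omega
        · right
          have hv3 : v ∉ cellCube z c m (a + 1) := fun h => hv2 ⟨h, hvS⟩
          rw [mem_cellCube] at hv3
          push Not at hv3
          obtain ⟨i, hi⟩ := hv3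
          rw [Finset.mem_biUnion]
          refine ⟨i, Finset.mem_univ _, ?_⟩
          have hin : ∀ j, c j ≤ z v j ∧ z v j < c j + m := fun j => by
            have := hv1' j
            omega
          rw [Finset.mem_union, mem_cellSlab, mem_cellSlab]
          have := hv1' i
          push_cast at hi
          by_cases h : z v i = c i + a
          · exact Or.inl ⟨hin, h⟩
          · exact Or.inr ⟨hin, by have := hi (by omega); omega⟩
      have hTcard : T.card ≤ (S ∩ cellCube z c m 0).card + D * (2 * (κ * m ^ (D - 1))) := by
        refine (Finset.card_le_card hTsub).trans ((Finset.card_union_le _ _).trans ?_)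
        refine Nat.add_le_add_left ?_ _
        refine (Finset.card_biUnion_le_card_mul _ _ (2 * (κ * m ^ (D - 1))) ?_).trans ?_
        · intro i _
          refine (Finset.card_union_le _ _).trans ?_
          have h1 := card_cellSlab_le hκ c m i (c i + a)
          have h2 := card_cellSlab_le hκ c m i (c i + m - a - 1)
          omega
        · simp
      have hTd : C.Dressed T := by
        refine C.dressed_of_card_lt ?_
        have := C.pos
        have e : 8 * D * κ * m ^ (D - 1) = 4 * (D * (2 * (κ * m ^ (D - 1)))) := by ring
        omega
      rw [← hWT]
      refine C.dressed_union hWb hTd Finset.disjoint_sdiff ?_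
      intro w hw v hv hwv
      rw [hWT] at hv
      refine hv ?_
      rw [hW, Finset.mem_sdiff] at hw
      have hz := hS w v hwv hw.2
      have hw1 := mem_cellCube.1 hw.1
      refine mem_cellCube.2 fun i => ?_
      have h1 := abs_le.1 (hz i)
      have h2 := hw1 i
      push_cast at h2
      omega
  exact key m 0 (by omega)

/-- Dyadic subdivision: a cube with many bad vertices is halved in every direction, after removal
of the layers that separate the halves.  A cube is only halved if it contains more than `d / 4` bad
vertices, so the removed layers are charged to these; the cost of the later subdivisions is a
geometric series because `D ≥ 2`. -/
theorem exists_bare_cellCube_sdiff (C : CorrectableSets adj d) (hD : 2 ≤ D) {z : V → Fin D → ℤ}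
    {κ : ℕ} (hκ : ∀ c, (Finset.univ.filter fun v => z v = c).card ≤ κ) {S : Finset V}
    (hS : ∀ u v, adj u v → u ∉ S → ∀ i, |z u i - z v i| ≤ 1) (N : ℕ) :
    ∀ c : Fin D → ℤ, 8 * D * κ * (2 ^ N) ^ (D - 1) ≤ d →
      ∃ B, C.Bare (cellCube z c (2 ^ N) 0 \ (S ∪ B)) ∧
        d * B.card ≤ 8 * D * κ * (2 ^ N) ^ (D - 1) * (S ∩ cellCube z c (2 ^ N) 0).card := by
  induction N with
  | zero =>
    intro c h
    refine ⟨∅, ?_, by simp⟩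
    refine C.bare_mono Finset.sdiff_subset (C.bare_of_dressed (C.dressed_of_card_lt ?_))
    have h1 : (cellCube z c (2 ^ 0) 0).card ≤ κ := by
      refine (Finset.card_le_card ?_).trans (hκ c)
      intro v hv
      rw [mem_cellCube] at hv
      rw [Finset.mem_filter]
      refine ⟨Finset.mem_univ _, funext fun i => ?_⟩
      have := hv i
      push_cast at this
      omega
    have := C.pos
    simp only [pow_zero, one_pow, mul_one] at h
    have h3 : 16 * κ ≤ 8 * D * κ := Nat.mul_le_mul_right _ (by omega)
    rw [pow_zero] at h1 ⊢
    omega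
  | succ N ih =>
    intro c h
    by_cases hs : 4 * (S ∩ cellCube z c (2 ^ (N + 1)) 0).card ≤ d
    · refine ⟨∅, ?_, by simp⟩
      exact C.bare_mono Finset.sdiff_subset
        (C.bare_of_dressed (dressed_cellCube C (by omega) hκ hS c _ h hs))
    push Not at hs
    have hpow : 2 * (2 ^ N) ^ (D - 1) ≤ (2 ^ (N + 1)) ^ (D - 1) := by
      rw [pow_succ 2 N, mul_pow, mul_comm]
      exact Nat.mul_le_mul_left _ (Nat.le_self_pow (by omega) 2)
    have h' : 8 * D * κ * (2 ^ N) ^ (D - 1) ≤ d :=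
      (Nat.mul_le_mul_left _ (by omega)).trans h
    -- `e i` records whether the child cube is the upper or the lower half in direction `i`
    let ch : (Fin D → Bool) → Fin D → ℤ := fun e i => c i + if e i then 2 ^ N else 0
    choose B hB hBc using fun e => ih (ch e) h'
    set Sl : Finset V := Finset.univ.biUnion fun i =>
      cellSlab z c (2 ^ (N + 1)) i (c i + 2 ^ N - 1) with hSl
    set F : Finset V := Finset.univ.biUnion B with hF
    let f : V → Fin D → Bool := fun v i => decide (c i + 2 ^ N ≤ z v i)
    have hchild : ∀ v, v ∈ cellCube z c (2 ^ (N + 1)) 0 → v ∈ cellCube z (ch (f v)) (2 ^ N) 0 := by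
      intro v hv
      rw [mem_cellCube] at hv ⊢
      intro i
      have hvi := hv i
      have hc : ch (f v) i = c i + if c i + 2 ^ N ≤ z v i then 2 ^ N else 0 := by
        simp [ch, f]
      rw [hc]
      push_cast [pow_succ] at hvi ⊢
      split_ifs with hh
      · constructor <;> linarith [hvi.1, hvi.2]
      · constructor <;> linarith [hvi.1, hvi.2]
    refine ⟨Sl ∪ F, ?_, ?_⟩
    · refine C.bare_of_label f _ ?_ ?_
      · intro e
        refine C.bare_mono ?_ (hB e)
        intro v hv
        simp only [Finset.mem_filter, Finset.mem_sdiff, Finset.mem_union, not_or] at hv ⊢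
        obtain ⟨⟨hv1, hv2, hv3, hv4⟩, rfl⟩ := hv
        refine ⟨hchild v hv1, hv2, fun hh => hv4 ?_⟩
        exact Finset.mem_biUnion.2 ⟨_, Finset.mem_univ _, hh⟩
      · intro u hu v hv hne huv
        simp only [Finset.mem_sdiff, Finset.mem_union, not_or] at hu hv
        obtain ⟨i, hi⟩ := Function.ne_iff.1 hne
        have h1 := abs_le.1 (hS u v huv hu.2.1 i)
        have nslab : ∀ w, w ∈ cellCube z c (2 ^ (N + 1)) 0 → w ∉ Sl →
            z w i ≠ c i + 2 ^ N - 1 := by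
          intro w hw hwS hh
          refine hwS (Finset.mem_biUnion.2 ⟨i, Finset.mem_univ _, mem_cellSlab.2 ⟨fun j => ?_, hh⟩⟩)
          have := mem_cellCube.1 hw j
          simpa using this
        have hu' := nslab u hu.1 hu.2.2.1
        have hv' := nslab v hv.1 hv.2.2.1
        have hi' : ¬ (c i + 2 ^ N ≤ z u i ↔ c i + 2 ^ N ≤ z v i) := by
          simpa [f] using hi
        apply hi'
        generalize c i + (2 : ℤ) ^ N = t at *
        omega
    · have hsum : ∑ e, (S ∩ cellCube z (ch e) (2 ^ N) 0).card
          ≤ (S ∩ cellCube z c (2 ^ (N + 1)) 0).card := by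
        rw [Finset.card_eq_sum_card_fiberwise (f := f) (t := Finset.univ)
          (fun _ _ => Finset.mem_coe.2 (Finset.mem_univ _))]
        refine Finset.sum_le_sum fun e _ => Finset.card_le_card ?_
        intro v hv
        rw [Finset.mem_inter, mem_cellCube] at hv
        rw [Finset.mem_filter, Finset.mem_inter, mem_cellCube]
        have hp : (0 : ℤ) < 2 ^ N := by positivity
        refine ⟨⟨hv.1, fun i => ?_⟩, funext fun i => ?_⟩
        · have := hv.2 i
          simp only [ch] at this
          push_cast [pow_succ] at this ⊢
          split_ifs at this <;> constructor <;> linarith [this.1, this.2]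
        · have := hv.2 i
          simp only [ch] at this
          push_cast at this
          cases hei : e i
          · simp only [hei, f] at this ⊢
            simp only [decide_eq_false_iff_not]
            simp at this
            linarith
          · simp only [hei, f] at this ⊢
            simp only [decide_eq_true_eq]
            simp at this
            linarith
      have hSlc : Sl.card ≤ D * (κ * (2 ^ (N + 1)) ^ (D - 1)) := by
        refine (Finset.card_biUnion_le_card_mul _ _ _ fun i _ =>
          card_cellSlab_le hκ c _ i _).trans ?_
        simp
      have hFc : d * F.card ≤ 8 * D * κ * (2 ^ N) ^ (D - 1) *
          (S ∩ cellCube z c (2 ^ (N + 1)) 0).card := by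
        calc d * F.card ≤ d * ∑ e, (B e).card := Nat.mul_le_mul_left _ Finset.card_biUnion_le
          _ = ∑ e, d * (B e).card := Finset.mul_sum _ _ _
          _ ≤ ∑ e, 8 * D * κ * (2 ^ N) ^ (D - 1) * (S ∩ cellCube z (ch e) (2 ^ N) 0).card :=
            Finset.sum_le_sum fun e _ => hBc e
          _ = 8 * D * κ * (2 ^ N) ^ (D - 1) * ∑ e, (S ∩ cellCube z (ch e) (2 ^ N) 0).card :=
            (Finset.mul_sum _ _ _).symm
          _ ≤ _ := Nat.mul_le_mul_left _ hsum
      set s := (S ∩ cellCube z c (2 ^ (N + 1)) 0).card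
      set X := (2 ^ (N + 1)) ^ (D - 1)
      set Y := (2 ^ N) ^ (D - 1)
      have e1 : d * Sl.card ≤ 4 * s * (D * (κ * X)) := Nat.mul_le_mul hs.le hSlc
      have e2 : 8 * D * κ * Y * s ≤ 4 * s * (D * (κ * X)) := by
        calc 8 * D * κ * Y * s = 4 * s * (D * (κ * (2 * Y))) := by ring
          _ ≤ _ := by gcongr
      calc d * (Sl ∪ F).card ≤ d * (Sl.card + F.card) :=
            Nat.mul_le_mul_left _ (Finset.card_union_le _ _)
        _ = d * Sl.card + d * F.card := Nat.mul_add _ _ _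
        _ ≤ 4 * s * (D * (κ * X)) + 4 * s * (D * (κ * X)) := by omega
        _ = 8 * D * κ * X * s := by ring

/-- All vertices but a small exceptional set form a `Bare` set: cut the lattice of cells into cubes
of side `2 ^ N`, along hyperplanes that are chosen, by averaging over the translates, to contain few
vertices, and subdivide the cubes. -/
theorem exists_bare_compl (C : CorrectableSets adj d) (hD : 2 ≤ D) {z : V → Fin D → ℤ}
    {κ : ℕ} (hκ : ∀ c, (Finset.univ.filter fun v => z v = c).card ≤ κ) {S : Finset V}
    (hS : ∀ u v, adj u v → u ∉ S → ∀ i, |z u i - z v i| ≤ 1) (N : ℕ)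
    (h : 8 * D * κ * (2 ^ N) ^ (D - 1) ≤ d) :
    ∃ B : Finset V, C.Bare Bᶜ ∧
      B.card * 2 ^ N ≤ 2 * S.card * 2 ^ N + D * Fintype.card V := by
  set M : ℤ := 2 ^ N with hM
  have hMpos : 0 < M := by positivity
  have hpig : ∀ i, ∃ r : ℤ, 0 ≤ r ∧ r < M ∧
      2 ^ N * (Finset.univ.filter fun v => z v i % M = r).card ≤ Fintype.card V := by
    intro i
    by_contra hcon
    push Not at hcon
    have hlt : ∑ r ∈ Finset.Ico 0 M, Fintype.card V <
        ∑ r ∈ Finset.Ico 0 M, 2 ^ N * (Finset.univ.filter fun v => z v i % M = r).card := by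
      refine Finset.sum_lt_sum_of_nonempty ⟨0, Finset.mem_Ico.2 ⟨le_rfl, hMpos⟩⟩ ?_
      intro r hr
      rw [Finset.mem_Ico] at hr
      exact hcon r hr.1 hr.2
    rw [← Finset.mul_sum, ← Finset.card_eq_sum_card_fiberwise (f := fun v => z v i % M)
      (t := Finset.Ico 0 M) (s := Finset.univ), Finset.sum_const, Int.card_Ico] at hlt
    · have e : ((2 : ℤ) ^ N).toNat = 2 ^ N := by
        rw [show (2 : ℤ) ^ N = ((2 ^ N : ℕ) : ℤ) by push_cast; rfl, Int.toNat_natCast]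
      simp [hM, Finset.card_univ, e] at hlt
    · intro v _
      exact Finset.mem_coe.2
        (Finset.mem_Ico.2 ⟨Int.emod_nonneg _ hMpos.ne', Int.emod_lt_of_pos _ hMpos⟩)
  choose r hr0 hrM hr using hpig
  set H : Finset V := Finset.univ.biUnion fun i => Finset.univ.filter fun v => z v i % M = r i
    with hH
  let f : V → Fin D → ℤ := fun v i => (z v i - r i - 1) / M
  let co : (Fin D → ℤ) → Fin D → ℤ := fun a i => M * a i + r i + 1
  have hcube : ∀ v a, v ∈ cellCube z (co a) (2 ^ N) 0 ↔ f v = a := by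
    intro v a
    rw [mem_cellCube, funext_iff]
    refine forall_congr' fun i => ?_
    simp only [co, f]
    push_cast
    rw [← hM]
    have e := Int.mul_ediv_add_emod (z v i - r i - 1) M
    have e1 := Int.emod_nonneg (z v i - r i - 1) hMpos.ne'
    have e2 := Int.emod_lt_of_pos (z v i - r i - 1) hMpos
    constructor
    · rintro ⟨g1, g2⟩
      refine le_antisymm (Int.lt_add_one_iff.1 ?_) ?_
      · rw [Int.ediv_lt_iff_lt_mul hMpos]
        linarith
      · rw [Int.le_ediv_iff_mul_le hMpos]
        linarith
    · intro g
      rw [g] at e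
      constructor <;> linarith
  choose B hB hBc using fun a => exists_bare_cellCube_sdiff C hD hκ hS N (co a) h
  set F : Finset V := (Finset.univ.image f).biUnion B with hF
  refine ⟨S ∪ (H ∪ F), ?_, ?_⟩
  · refine C.bare_of_label f _ ?_ ?_
    · intro a
      refine C.bare_mono ?_ (hB a)
      intro v hv
      simp only [Finset.mem_filter, Finset.mem_compl, Finset.mem_sdiff, Finset.mem_union,
        not_or] at hv ⊢
      obtain ⟨⟨hv2, hv3, hv4⟩, rfl⟩ := hv
      refine ⟨(hcube v _).2 rfl, hv2, fun hh => hv4 ?_⟩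
      exact Finset.mem_biUnion.2 ⟨_, Finset.mem_image_of_mem _ (Finset.mem_univ v), hh⟩
    · intro u hu v hv hne huv
      simp only [Finset.mem_compl, Finset.mem_union, not_or] at hu hv
      obtain ⟨i, hi⟩ := Function.ne_iff.1 hne
      have h1 := abs_le.1 (hS u v huv hu.1 i)
      have nH : ∀ w, w ∉ H → z w i % M ≠ r i := fun w hw hh =>
        hw (Finset.mem_biUnion.2 ⟨i, Finset.mem_univ _, by simpa using hh⟩)
      have aux : ∀ x y : ℤ, y ≤ x + 1 → (x - r i - 1) / M < (y - r i - 1) / M →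
          x % M = r i := by
        intro x y hxy hlt
        have e := Int.mul_ediv_add_emod (x - r i - 1) M
        have e2 := Int.emod_lt_of_pos (x - r i - 1) hMpos
        have e' := Int.mul_ediv_add_emod (y - r i - 1) M
        have e1' := Int.emod_nonneg (y - r i - 1) hMpos.ne'
        have hq : M * ((x - r i - 1) / M) + M ≤ M * ((y - r i - 1) / M) := by
          have := mul_le_mul_of_nonneg_left (Int.add_one_le_of_lt hlt) hMpos.le
          linarith
        have hx : x = r i + M * ((x - r i - 1) / M + 1) := by linarith
        rw [hx, Int.add_mul_emod_self_left, Int.emod_eq_of_lt (hr0 i) (hrM i)]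
      rcases lt_or_gt_of_ne hi with hlt | hlt
      · exact nH u hu.2.1 (aux _ _ (by linarith) hlt)
      · exact nH v hv.2.1 (aux _ _ (by linarith) hlt)
  · have hHc : H.card * 2 ^ N ≤ D * Fintype.card V := by
      calc H.card * 2 ^ N
          ≤ (∑ i, (Finset.univ.filter fun v => z v i % M = r i).card) * 2 ^ N :=
            Nat.mul_le_mul_right _ Finset.card_biUnion_le
        _ = ∑ i, 2 ^ N * (Finset.univ.filter fun v => z v i % M = r i).card := by
            rw [Finset.sum_mul]
            exact Finset.sum_congr rfl fun i _ => mul_comm _ _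
        _ ≤ ∑ _i : Fin D, Fintype.card V := Finset.sum_le_sum fun i _ => hr i
        _ = D * Fintype.card V := by simp
    have hFc : F.card ≤ S.card := by
      refine Nat.le_of_mul_le_mul_left ?_ C.pos
      calc d * F.card ≤ d * ∑ a ∈ Finset.univ.image f, (B a).card :=
            Nat.mul_le_mul_left _ Finset.card_biUnion_le
        _ = ∑ a ∈ Finset.univ.image f, d * (B a).card := Finset.mul_sum _ _ _
        _ ≤ ∑ a ∈ Finset.univ.image f, d * (S.filter (f · = a)).card := by
            refine Finset.sum_le_sum fun a _ => (hBc a).trans (Nat.mul_le_mul h ?_)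
            refine Finset.card_le_card fun v hv => ?_
            rw [Finset.mem_inter, hcube] at hv
            exact Finset.mem_filter.2 hv
        _ = d * S.card := by
            rw [← Finset.mul_sum, ← Finset.card_eq_sum_card_fiberwise]
            intro v _
            exact Finset.mem_coe.2 (Finset.mem_image_of_mem _ (Finset.mem_univ v))
    calc (S ∪ (H ∪ F)).card * 2 ^ N ≤ (S.card + (H.card + S.card)) * 2 ^ N := by
          refine Nat.mul_le_mul_right _ ((Finset.card_union_le _ _).trans ?_)
          have := Finset.card_union_le H F
          omega
      _ = 2 * S.card * 2 ^ N + H.card * 2 ^ N := by ring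
      _ ≤ _ := by omega

end Cells

noncomputable section

/-! ### From the embedding to lattice cells -/

/-- Two distinct qubits interact: they both lie in the support of one of the operators `gens`. -/
def Interacts {n : ℕ} (gens : Set (QOp n)) (u v : Fin n) : Prop :=
  u ≠ v ∧ ∃ M ∈ gens, u ∈ opSupport M ∧ v ∈ opSupport M

/-- The cell of a qubit in the cubic lattice of side `ℓ`. -/
def latticeCell {n D : ℕ} (ι : Fin n → EuclideanSpace ℝ (Fin D)) (ℓ : ℝ) (v : Fin n)
    (i : Fin D) : ℤ :=
  ⌊ι v i / ℓ⌋

theorem card_latticeCell_le {n D : ℕ} (hD : 0 < D) {ι : Fin n → EuclideanSpace ℝ (Fin D)}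
    (hι : IsQubitEmbedding ι) {ℓ : ℝ} (hℓ : 1 ≤ ℓ) (c : Fin D → ℤ) :
    (Finset.univ.filter fun v => latticeCell ι ℓ v = c).card ≤ ⌈D * ℓ⌉₊ ^ D := by
  set q := ⌈D * ℓ⌉₊ with hq
  have hD' : (0 : ℝ) < D := by exact_mod_cast hD
  have hℓ0 : 0 < ℓ := by linarith
  have hDl : 0 < D * ℓ := by positivity
  have hqD : D * ℓ ≤ q := Nat.le_ceil _
  have hq0 : (0 : ℝ) < q := hDl.trans_le hqD
  let w : Fin n → Fin D → ℤ := fun v i => ⌊(ι v i / ℓ - c i) * q⌋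
  have hcard : (Fintype.piFinset fun _ : Fin D => Finset.Ico (0 : ℤ) q).card = q ^ D := by
    simp
  rw [← hcard]
  refine Finset.card_le_card_of_injOn w ?_ ?_
  · intro v hv
    have hv' := (Finset.mem_filter.1 (Finset.mem_coe.1 hv)).2
    refine Finset.mem_coe.2 (Fintype.mem_piFinset.2 fun i => ?_)
    have hi : ⌊ι v i / ℓ⌋ = c i := congrFun hv' i
    have h1 := Int.floor_le (ι v i / ℓ)
    have h2 := Int.lt_floor_add_one (ι v i / ℓ)
    rw [hi] at h1 h2
    rw [Finset.mem_Ico]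
    constructor
    · exact Int.floor_nonneg.2 (mul_nonneg (by linarith) hq0.le)
    · rw [Int.floor_lt]
      push_cast
      nlinarith
  · intro u hu v hv huv
    by_contra hne
    have h1 := hι u v hne
    have hco : ∀ i, (ι u i - ι v i) ^ 2 < 1 / D := by
      intro i
      have hf : ⌊(ι u i / ℓ - c i) * q⌋ = ⌊(ι v i / ℓ - c i) * q⌋ := congrFun huv i
      have hlt := Int.abs_sub_lt_one_of_floor_eq_floor hf
      have e : (ι u i / ℓ - c i) * q - (ι v i / ℓ - c i) * q = (ι u i - ι v i) * (q / ℓ) := by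
        field_simp
        ring
      rw [e, abs_mul, abs_of_pos (div_pos hq0 hℓ0)] at hlt
      have hDq : (D : ℝ) ≤ q / ℓ := by rwa [le_div_iff₀ hℓ0]
      have h2 : |ι u i - ι v i| * D < 1 :=
        (mul_le_mul_of_nonneg_left hDq (abs_nonneg _)).trans_lt hlt
      have h3 : |ι u i - ι v i| < 1 / D := by rwa [lt_div_iff₀ hD']
      have h4 : (1 : ℝ) / D ≤ 1 := by
        rw [div_le_one hD']; exact_mod_cast hD
      rw [← sq_abs]
      nlinarith [abs_nonneg (ι u i - ι v i)]
    have : dist (ι u) (ι v) < 1 := by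
      rw [EuclideanSpace.dist_eq, Real.sqrt_lt' one_pos, one_pow]
      calc ∑ i, dist (ι u i) (ι v i) ^ 2 = ∑ i, (ι u i - ι v i) ^ 2 := by
            simp [Real.dist_eq, sq_abs]
        _ < ∑ _i : Fin D, 1 / (D : ℝ) :=
            Finset.sum_lt_sum_of_nonempty ⟨⟨0, hD⟩, Finset.mem_univ _⟩ fun i _ => hco i
        _ = 1 := by simp [hD'.ne']
    linarith

theorem abs_latticeCell_sub_le {n D : ℕ} {ι : Fin n → EuclideanSpace ℝ (Fin D)} {ℓ : ℝ}
    (hℓ : 0 < ℓ) {u v : Fin n} (h : dist (ι u) (ι v) < ℓ) (i : Fin D) :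
    |latticeCell ι ℓ u i - latticeCell ι ℓ v i| ≤ 1 := by
  have h1 : |ι u i - ι v i| < ℓ := by
    refine lt_of_le_of_lt ?_ h
    rw [dist_eq_norm]
    exact PiLp.norm_apply_le (ι u - ι v) i
  have h2 : |ι u i / ℓ - ι v i / ℓ| < 1 := by
    rwa [← sub_div, abs_div, abs_of_pos hℓ, div_lt_one hℓ]
  rw [abs_lt] at h2
  unfold latticeCell
  have a1 := Int.floor_le (ι u i / ℓ)
  have a2 := Int.lt_floor_add_one (ι u i / ℓ)
  have b1 := Int.floor_le (ι v i / ℓ)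
  have b2 := Int.lt_floor_add_one (ι v i / ℓ)
  rw [abs_le]
  constructor
  · have : (⌊ι v i / ℓ⌋ : ℝ) < ⌊ι u i / ℓ⌋ + 2 := by linarith
    have : ⌊ι v i / ℓ⌋ < ⌊ι u i / ℓ⌋ + 2 := by exact_mod_cast this
    omega
  · have : (⌊ι u i / ℓ⌋ : ℝ) < ⌊ι v i / ℓ⌋ + 2 := by linarith
    have : ⌊ι u i / ℓ⌋ < ⌊ι v i / ℓ⌋ + 2 := by exact_mod_cast this
    omega

/-- The constant `c₀` of the bounds; the constant `c₁` is `c₀⁻²`, which makes all the length scales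
in question at least `1`. -/
def localityConst (D : ℕ) : ℝ := 1 / (8 * D * (D + 1))

theorem localityConst_pos {D : ℕ} (hD : 0 < D) : 0 < localityConst D := by
  have : (0 : ℝ) < D := by exact_mod_cast hD
  unfold localityConst
  positivity

theorem localityConst_le_one {D : ℕ} (hD : 0 < D) : localityConst D ≤ 1 := by
  have : (1 : ℝ) ≤ D := by exact_mod_cast hD
  unfold localityConst
  rw [div_le_one (by positivity)]
  nlinarith

/-- If fewer than `c₀ K` interactions have length at least `ℓ`, then all but fewer than `K` qubits
form a `Bare` set.  The lattice has cells of side `ℓ`, and it is cut into the largest dyadic cubes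
whose boundary layers have fewer than `d` qubits.  The bound on `ℓ` says that such a cube has more
than `4 D n / K` cells in each direction, so the cut costs fewer than `K / 4` qubits. -/
theorem exists_bare_compl_card_lt {n D d K : ℕ} (hD : 2 ≤ D) {gens : Set (QOp n)}
    (C : CorrectableSets (Interacts gens) d) {ι : Fin n → EuclideanSpace ℝ (Fin D)}
    (hι : IsQubitEmbedding ι) {ℓ : ℝ} (hℓ : 1 ≤ ℓ) (hK : 0 < K) (hKn : K ≤ n)
    (hℓK : ℓ ^ D * (n : ℝ) ^ (D - 1) ≤ localityConst D ^ D * (d * (K : ℝ) ^ (D - 1)))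
    (hL : ((longInteractions gens ι ℓ).ncard : ℝ) < localityConst D * K) :
    ∃ B : Finset (Fin n), C.Bare Bᶜ ∧ B.card < K := by
  classical
  have hDpos : (0 : ℝ) < D := by exact_mod_cast (by omega : 0 < D)
  have hD1 : (1 : ℝ) ≤ D := by exact_mod_cast (by omega : 1 ≤ D)
  have hn : (0 : ℝ) < n := by exact_mod_cast hK.trans_le hKn
  have hKr : (0 : ℝ) < K := by exact_mod_cast hK
  have hd : (0 : ℝ) < d := by exact_mod_cast C.pos
  have hℓ0 : 0 < ℓ := by linarith
  have hc0 : 0 < localityConst D := localityConst_pos (by omega)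
  set L := (longInteractions gens ι ℓ).toFinset with hLdef
  set S : Finset (Fin n) := L.image Prod.fst ∪ L.image Prod.snd with hSdef
  have hScard : S.card ≤ 2 * L.card := by
    refine (Finset.card_union_le _ _).trans ?_
    have h1 : (L.image Prod.fst).card ≤ L.card := Finset.card_image_le
    have h2 : (L.image Prod.snd).card ≤ L.card := Finset.card_image_le
    omega
  have hLcard : (L.card : ℝ) < localityConst D * K := by
    rwa [hLdef, ← Set.ncard_eq_toFinset_card']
  have hS : ∀ u v, Interacts gens u v → u ∉ S →
      ∀ i, |latticeCell ι ℓ u i - latticeCell ι ℓ v i| ≤ 1 := by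
    rintro u v ⟨hne, M, hM, hu, hv⟩ huS
    refine abs_latticeCell_sub_le hℓ0 ?_
    by_contra hlong
    push Not at hlong
    apply huS
    rcases lt_or_gt_of_ne hne with h | h
    · refine Finset.mem_union_left _ (Finset.mem_image.2 ⟨(u, v), ?_, rfl⟩)
      rw [hLdef, Set.mem_toFinset]
      exact ⟨h, ⟨M, hM, hu, hv⟩, hlong⟩
    · refine Finset.mem_union_right _ (Finset.mem_image.2 ⟨(v, u), ?_, rfl⟩)
      rw [hLdef, Set.mem_toFinset]
      exact ⟨h, ⟨M, hM, hv, hu⟩, by rwa [dist_comm] at hlong⟩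
  set q := ⌈D * ℓ⌉₊ with hq
  have hqpos : 0 < q := Nat.ceil_pos.2 (by positivity)
  have hqle : (q : ℝ) ≤ (D + 1) * ℓ := by
    have := (Nat.ceil_lt_add_one (by positivity : 0 ≤ D * ℓ)).le
    rw [← hq] at this
    linarith
  -- the numerical identity that fixes the choice of `c₀`
  have hconst : 8 * D * ((D + 1) ^ D * localityConst D ^ D) = (1 / (8 * D : ℝ)) ^ (D - 1) := by
    obtain ⟨E, rfl⟩ : ∃ E, D = E + 1 := ⟨D - 1, by omega⟩
    rw [← mul_pow, Nat.add_sub_cancel]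
    have : ((((E + 1 : ℕ) : ℝ)) + 1) * localityConst (E + 1) = 1 / (8 * ((E + 1 : ℕ) : ℝ)) := by
      unfold localityConst
      field_simp
    rw [this, pow_succ]
    field_simp
  have hstep : ∀ X : ℝ, 0 ≤ X → 8 * D * (q : ℝ) ^ D * X * (n : ℝ) ^ (D - 1) ≤
      d * ((1 / (8 * D : ℝ)) ^ (D - 1) * (K : ℝ) ^ (D - 1) * X) := by
    intro X hX
    calc 8 * D * (q : ℝ) ^ D * X * (n : ℝ) ^ (D - 1)
        ≤ 8 * D * ((D + 1) * ℓ) ^ D * X * (n : ℝ) ^ (D - 1) := by gcongr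
      _ = 8 * D * (D + 1) ^ D * X * (ℓ ^ D * (n : ℝ) ^ (D - 1)) := by rw [mul_pow]; ring
      _ ≤ 8 * D * (D + 1) ^ D * X * (localityConst D ^ D * (d * (K : ℝ) ^ (D - 1))) := by gcongr
      _ = d * ((8 * D * ((D + 1) ^ D * localityConst D ^ D)) * (K : ℝ) ^ (D - 1) * X) := by ring
      _ = _ := by rw [hconst]
  have hex : ∃ N, ¬ 8 * D * q ^ D * (2 ^ N) ^ (D - 1) ≤ d := by
    refine ⟨d, ?_⟩
    push Not
    have h1 : d < 2 ^ d := Nat.lt_two_pow_self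
    have h2 : 2 ^ d ≤ (2 ^ d) ^ (D - 1) := Nat.le_self_pow (by omega) _
    have h3 : 0 < 8 * D * q ^ D := by positivity
    nlinarith
  have hfind := Nat.find_spec hex
  have hzero : 8 * D * q ^ D * (2 ^ 0) ^ (D - 1) ≤ d := by
    have h1 := hstep 1 zero_le_one
    have h2 : (1 / (8 * D : ℝ)) ^ (D - 1) * (K : ℝ) ^ (D - 1) * 1 ≤ (n : ℝ) ^ (D - 1) := by
      rw [mul_one, ← mul_pow]
      have : 1 / (8 * D : ℝ) ≤ 1 := by
        rw [div_le_one (by positivity)]; linarith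
      have hKn' : (K : ℝ) ≤ n := by exact_mod_cast hKn
      gcongr
      nlinarith
    have h3 : 8 * D * (q : ℝ) ^ D * 1 * (n : ℝ) ^ (D - 1) ≤ d * (n : ℝ) ^ (D - 1) :=
      h1.trans (by gcongr)
    have h4 := le_of_mul_le_mul_right h3 (by positivity)
    rw [pow_zero, one_pow]
    exact_mod_cast h4
  obtain ⟨N, hN⟩ : ∃ N, Nat.find hex = N + 1 := by
    refine ⟨Nat.find hex - 1, ?_⟩
    have : Nat.find hex ≠ 0 := by
      intro h0
      rw [h0] at hfind
      exact hfind hzero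
    omega
  have hNle : 8 * D * q ^ D * (2 ^ N) ^ (D - 1) ≤ d := by
    have := Nat.find_min hex (m := N) (by omega)
    push Not at this
    exact this
  rw [hN] at hfind
  push Not at hfind
  have hnK : (n : ℝ) < 1 / (8 * D) * K * 2 ^ (N + 1) := by
    have h1 := hstep ((2 ^ (N + 1)) ^ (D - 1)) (by positivity)
    have h2 : (d : ℝ) < 8 * D * (q : ℝ) ^ D * (2 ^ (N + 1)) ^ (D - 1) := by exact_mod_cast hfind
    have h3 : (d : ℝ) * (n : ℝ) ^ (D - 1) <
        d * ((1 / (8 * D : ℝ)) ^ (D - 1) * (K : ℝ) ^ (D - 1) * (2 ^ (N + 1)) ^ (D - 1)) :=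
      (mul_lt_mul_of_pos_right h2 (by positivity)).trans_le h1
    have h4 := lt_of_mul_lt_mul_left h3 hd.le
    rw [← mul_pow, ← mul_pow] at h4
    exact lt_of_pow_lt_pow_left₀ _ (by positivity) h4
  obtain ⟨B, hB, hBc⟩ := exists_bare_compl C hD
    (card_latticeCell_le (by omega) hι hℓ) hS N hNle
  refine ⟨B, hB, ?_⟩
  have hBc' : (B.card : ℝ) * 2 ^ N ≤ 2 * S.card * 2 ^ N + D * n := by
    have : B.card * 2 ^ N ≤ 2 * S.card * 2 ^ N + D * n := by simpa using hBc
    exact_mod_cast this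
  have hS' : (S.card : ℝ) ≤ 2 * L.card := by exact_mod_cast hScard
  have hc16 : localityConst D ≤ 1 / 16 := by
    unfold localityConst
    have : (16 : ℝ) ≤ 8 * D * (D + 1) := by nlinarith
    gcongr
  have hP : (0 : ℝ) < 2 ^ N := by positivity
  have hDn : D * n < K / 4 * (2 : ℝ) ^ N := by
    have : D * (n : ℝ) < D * (1 / (8 * D) * K * 2 ^ (N + 1)) := by gcongr
    refine this.trans_eq ?_
    rw [pow_succ]
    field_simp
    ring
  have hSK : (S.card : ℝ) ≤ K / 8 := by nlinarith
  have : (B.card : ℝ) * 2 ^ N < K * 2 ^ N := by nlinarith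
  have := lt_of_mul_lt_mul_right this hP.le
  exact_mod_cast this

/-! ### The length scale -/

theorem pow_lengthScale_dist {n d D : ℕ} (hD : 2 ≤ D) (hn : 0 < n) :
    ((d : ℝ) / (n : ℝ) ^ (((D : ℝ) - 1) / D)) ^ D * (n : ℝ) ^ (D - 1) = d * (d : ℝ) ^ (D - 1) := by
  have hn' : (0 : ℝ) < n := by exact_mod_cast hn
  have hD' : (D : ℝ) ≠ 0 := by exact_mod_cast (by omega : D ≠ 0)
  have e : ((n : ℝ) ^ (((D : ℝ) - 1) / D)) ^ D = (n : ℝ) ^ (D - 1) := by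
    rw [← Real.rpow_natCast, ← Real.rpow_mul hn'.le, div_mul_cancel₀ _ hD',
      show (D : ℝ) - 1 = ((D - 1 : ℕ) : ℝ) by rw [Nat.cast_sub (by omega), Nat.cast_one],
      Real.rpow_natCast]
  rw [div_pow, e, div_mul_cancel₀ _ (by positivity), ← pow_succ', Nat.sub_add_cancel (by omega)]

theorem pow_lengthScale_dim {n k d D : ℕ} (hD : 2 ≤ D) (hn : 0 < n) :
    (((k : ℝ) * (d : ℝ) ^ (1 / ((D : ℝ) - 1)) / n) ^ (((D : ℝ) - 1) / D)) ^ D * (n : ℝ) ^ (D - 1) =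
      d * (k : ℝ) ^ (D - 1) := by
  have hn' : (0 : ℝ) < n := by exact_mod_cast hn
  have hD' : (D : ℝ) ≠ 0 := by exact_mod_cast (by omega : D ≠ 0)
  have hD1 : (D : ℝ) - 1 = ((D - 1 : ℕ) : ℝ) := by rw [Nat.cast_sub (by omega), Nat.cast_one]
  have hD1' : ((D - 1 : ℕ) : ℝ) ≠ 0 := by exact_mod_cast (by omega : D - 1 ≠ 0)
  rw [← Real.rpow_natCast _ D, ← Real.rpow_mul (by positivity), div_mul_cancel₀ _ hD', hD1,
    Real.rpow_natCast, div_pow, div_mul_cancel₀ _ (by positivity), mul_pow,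
    ← Real.rpow_natCast ((d : ℝ) ^ _), ← Real.rpow_mul (by positivity),
    div_mul_cancel₀ _ hD1', Real.rpow_one, mul_comm]

end

noncomputable section

/-! ### Pauli operators as symplectic vectors -/

/-- The labels of one-qubit Pauli operators as elements of `(ℤ/2)²`: `I = (0, 0)`, `X = (1, 0)`,
`Y = (1, 1)`, `Z = (0, 1)`. -/
def pauliLabel : Fin 4 ≃ ZMod 2 × ZMod 2 where
  toFun := ![(0, 0), (1, 0), (1, 1), (0, 1)]
  invFun v := if v = (0, 0) then 0 else if v = (1, 0) then 1 else if v = (1, 1) then 2 else 3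
  left_inv := by decide
  right_inv := by decide

/-- The sign `(-1)^t`. -/
def signOf (t : ZMod 2) : ℂ := if t = 0 then 1 else -1

theorem signOf_add (s t : ZMod 2) : signOf (s + t) = signOf s * signOf t := by
  have h : s + t = 0 ↔ (s = 0 ↔ t = 0) := by revert s t; decide
  unfold signOf
  by_cases hs : s = 0 <;> by_cases ht : t = 0 <;> simp [h, hs, ht]

theorem signOf_sum {α : Type*} (s : Finset α) (f : α → ZMod 2) :
    signOf (∑ i ∈ s, f i) = ∏ i ∈ s, signOf (f i) := by
  classical
  induction s using Finset.induction_on with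
  | empty => simp [signOf]
  | insert a s ha ih => rw [Finset.sum_insert ha, Finset.prod_insert ha, signOf_add, ih]

theorem pauliMat_mul_label (a b : Fin 4) : ∃ c : ℕ, pauliMat a * pauliMat b =
    Complex.I ^ c • pauliMat (pauliLabel.symm (pauliLabel a + pauliLabel b)) := by
  have h3 : Complex.I ^ 3 = -Complex.I := Complex.I_pow_three
  have htab : ∀ a b : Fin 4, pauliLabel.symm (pauliLabel a + pauliLabel b) =
      ![![0, 1, 2, 3], ![1, 0, 3, 2], ![2, 3, 0, 1], ![3, 2, 1, 0]] a b := by decide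
  rw [htab]
  refine ⟨![![0, 0, 0, 0], ![0, 0, 1, 3], ![0, 3, 0, 1], ![0, 1, 3, 0]] a b, ?_⟩
  fin_cases a <;> fin_cases b <;> ext i j <;> fin_cases i <;> fin_cases j <;> simp [pauliMat, h3]

theorem pauliMat_comm_label (a b : Fin 4) : pauliMat a * pauliMat b =
    signOf ((pauliLabel a).1 * (pauliLabel b).2 + (pauliLabel a).2 * (pauliLabel b).1) •
      (pauliMat b * pauliMat a) := by
  have htab : ∀ a b : Fin 4,
      (pauliLabel a).1 * (pauliLabel b).2 + (pauliLabel a).2 * (pauliLabel b).1 =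
      ![![0, 0, 0, 0], ![0, 0, 1, 1], ![0, 1, 0, 1], ![0, 1, 1, 0]] a b := by decide
  rw [htab]
  fin_cases a <;> fin_cases b <;> ext i j <;> fin_cases i <;> fin_cases j <;>
    simp [pauliMat, signOf]

theorem pauliMat_conjTranspose (a : Fin 4) : (pauliMat a).conjTranspose = pauliMat a := by
  fin_cases a <;> ext i j <;> fin_cases i <;> fin_cases j <;> simp [pauliMat]

theorem pauliMat_trace (a : Fin 4) : (pauliMat a).trace = if a = 0 then 2 else 0 := by
  fin_cases a <;> simp [pauliMat, Matrix.trace_fin_two]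

/-- Symplectic vectors: one label for each qubit. -/
abbrev PauliVec (n : ℕ) : Type := Fin n → ZMod 2 × ZMod 2

variable {n : ℕ}

/-- The Hermitian tensor product of Pauli matrices with a given vector of labels. -/
def pauliTensor (v : PauliVec n) : QOp n := qTensor fun j => pauliMat (pauliLabel.symm (v j))

/-- The symplectic form on vectors of labels, which records whether two Pauli operators commute or
anticommute. -/
def pauliForm (n : ℕ) : LinearMap.BilinForm (ZMod 2) (PauliVec n) :=
  LinearMap.mk₂ (ZMod 2) (fun v w => ∑ j, ((v j).1 * (w j).2 + (v j).2 * (w j).1))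
    (fun a b c => by
      rw [← Finset.sum_add_distrib]
      exact Finset.sum_congr rfl fun j _ => by
        simp only [Pi.add_apply, Prod.fst_add, Prod.snd_add]; ring)
    (fun r a c => by
      rw [smul_eq_mul, Finset.mul_sum]
      exact Finset.sum_congr rfl fun j _ => by
        simp only [Pi.smul_apply, Prod.smul_fst, Prod.smul_snd, smul_eq_mul]; ring)
    (fun a b c => by
      rw [← Finset.sum_add_distrib]
      exact Finset.sum_congr rfl fun j _ => by
        simp only [Pi.add_apply, Prod.fst_add, Prod.snd_add]; ring)
    (fun r a c => by
      rw [smul_eq_mul, Finset.mul_sum]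
      exact Finset.sum_congr rfl fun j _ => by
        simp only [Pi.smul_apply, Prod.smul_fst, Prod.smul_snd, smul_eq_mul]; ring)

theorem pauliForm_apply (v w : PauliVec n) :
    pauliForm n v w = ∑ j, ((v j).1 * (w j).2 + (v j).2 * (w j).1) := rfl

theorem pauliForm_comm (v w : PauliVec n) : pauliForm n v w = pauliForm n w v := by
  simp only [pauliForm_apply]
  exact Finset.sum_congr rfl fun j _ => by ring

theorem pauliForm_single_right (v : PauliVec n) (q : Fin n) (t : ZMod 2 × ZMod 2) :
    pauliForm n v (Pi.single q t) = (v q).1 * t.2 + (v q).2 * t.1 := by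
  rw [pauliForm_apply, Finset.sum_eq_single q]
  · simp
  · intro j _ hj
    simp [hj]
  · simp

/-- The symplectic form is nondegenerate, qubit by qubit. -/
theorem exists_single_pauliForm {v : PauliVec n} {q : Fin n} (h : v q ≠ 0) :
    ∃ t, pauliForm n v (Pi.single q t) ≠ 0 := by
  simp only [pauliForm_single_right]
  generalize v q = s at h
  revert s
  decide

theorem pauliForm_nondegenerate : (pauliForm n).Nondegenerate := by
  have h : ∀ v : PauliVec n, (∀ w, pauliForm n v w = 0) → v = 0 := by
    intro v hv
    funext q
    by_contra hq
    obtain ⟨t, ht⟩ := exists_single_pauliForm hq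
    exact ht (hv _)
  refine ⟨h, fun v hv => h v fun w => ?_⟩
  rw [pauliForm_comm]
  exact hv w

theorem pauliForm_isRefl : (pauliForm n).IsRefl := fun v w h => by rwa [pauliForm_comm]

theorem pauliTensor_zero : pauliTensor (0 : PauliVec n) = 1 := by
  rw [← qTensor_one]
  rfl

theorem pauliTensor_mul (v w : PauliVec n) :
    ∃ c : ℕ, pauliTensor v * pauliTensor w = Complex.I ^ c • pauliTensor (v + w) := by
  choose e h using fun j => pauliMat_mul_label (pauliLabel.symm (v j)) (pauliLabel.symm (w j))
  refine ⟨∑ j, e j, ?_⟩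
  rw [pauliTensor, pauliTensor, qTensor_mul, funext h, qTensor_smul, Finset.prod_pow_eq_pow_sum]
  simp [pauliTensor]

theorem pauliTensor_sq (v : PauliVec n) : pauliTensor v * pauliTensor v = 1 := by
  rw [pauliTensor, qTensor_mul]
  simp only [pauliMat_sq]
  exact qTensor_one

theorem pauliTensor_comm (v w : PauliVec n) :
    pauliTensor v * pauliTensor w = signOf (pauliForm n v w) • (pauliTensor w * pauliTensor v) := by
  have h := fun j => pauliMat_comm_label (pauliLabel.symm (v j)) (pauliLabel.symm (w j))
  simp only [Equiv.apply_symm_apply] at h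
  rw [pauliTensor, pauliTensor, qTensor_mul, qTensor_mul, pauliForm_apply, signOf_sum,
    ← qTensor_smul]
  exact congrArg qTensor (funext h)

theorem pauliTensor_conjTranspose (v : PauliVec n) :
    (pauliTensor v).conjTranspose = pauliTensor v := by
  ext x y
  simp only [pauliTensor, qTensor, Matrix.conjTranspose_apply, Matrix.of_apply, star_prod]
  exact Finset.prod_congr rfl fun j _ => by
    rw [← Matrix.conjTranspose_apply, pauliMat_conjTranspose]

theorem qTensor_trace (A : Fin n → Matrix (Fin 2) (Fin 2) ℂ) :
    (qTensor A).trace = ∏ j, (A j).trace := by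
  simp only [Matrix.trace, Matrix.diag_apply, qTensor, Matrix.of_apply]
  rw [Finset.prod_univ_sum, Fintype.piFinset_univ]

theorem pauliTensor_trace (v : PauliVec n) :
    (pauliTensor v).trace = if v = 0 then 2 ^ n else 0 := by
  rw [pauliTensor, qTensor_trace]
  simp only [pauliMat_trace]
  have h0 : ∀ s : ZMod 2 × ZMod 2, pauliLabel.symm s = 0 ↔ s = 0 := by decide
  simp only [h0]
  split_ifs with h
  · subst h; simp
  · obtain ⟨j, hj⟩ := Function.ne_iff.1 h
    exact Finset.prod_eq_zero (Finset.mem_univ j) (if_neg hj)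

theorem pauliVec_add_self (v : PauliVec n) : v + v = 0 := by
  funext j
  exact Prod.ext (CharTwo.add_self_eq_zero _) (CharTwo.add_self_eq_zero _)

theorem pauliVec_add_eq_zero_iff {v w : PauliVec n} : v + w = 0 ↔ v = w := by
  constructor
  · intro h
    have : v + (w + w) = 0 + w := by rw [← add_assoc, h]
    simpa [pauliVec_add_self] using this
  · rintro rfl
    exact pauliVec_add_self v

theorem trace_pauliTensor_mul_of_ne {v w : PauliVec n} (h : v ≠ w) :
    (pauliTensor v * pauliTensor w).trace = 0 := by
  obtain ⟨c, hc⟩ := pauliTensor_mul v w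
  rw [hc, Matrix.trace_smul, pauliTensor_trace, if_neg (mt pauliVec_add_eq_zero_iff.1 h), smul_zero]

theorem trace_pauliTensor_mul_self (v : PauliVec n) :
    (pauliTensor v * pauliTensor v).trace = 2 ^ n := by
  rw [pauliTensor_sq, ← pauliTensor_zero, pauliTensor_trace, if_pos rfl]

theorem linearIndependent_pauliTensor :
    LinearIndependent ℂ (pauliTensor : PauliVec n → QOp n) := by
  rw [Fintype.linearIndependent_iff]
  intro g hg v
  have h := congrArg (fun M => (M * pauliTensor v).trace) hg
  simp only [Finset.sum_mul, smul_mul_assoc, Matrix.trace_sum, Matrix.trace_smul, zero_mul,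
    Matrix.trace_zero] at h
  rw [Finset.sum_eq_single v (fun w _ hw => by rw [trace_pauliTensor_mul_of_ne hw, smul_zero])
    (by simp), trace_pauliTensor_mul_self, smul_eq_mul] at h
  exact (mul_eq_zero.1 h).resolve_right (pow_ne_zero _ two_ne_zero)

/-- The Pauli operators are a basis of the space of all operators. -/
def pauliBasis (n : ℕ) : Module.Basis (PauliVec n) ℂ (QOp n) :=
  basisOfLinearIndependentOfCardEqFinrank linearIndependent_pauliTensor <| by
    simp [Module.finrank_matrix, ← mul_pow]

theorem pauliBasis_apply (v : PauliVec n) : pauliBasis n v = pauliTensor v := by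
  simp [pauliBasis]

/-! ### Supports -/

theorem pauliTensor_apply_update_right {w : PauliVec n} {q : Fin n} (hw : ∀ j, j ≠ q → w j = 0)
    (x : Fin n → Fin 2) (c : Fin 2) :
    pauliTensor w x (Function.update x q c) = pauliMat (pauliLabel.symm (w q)) (x q) c := by
  simp only [pauliTensor, qTensor, Matrix.of_apply]
  rw [Finset.prod_eq_single q]
  · simp
  · intro j _ hj
    rw [hw j hj, show pauliLabel.symm (0 : ZMod 2 × ZMod 2) = 0 by decide]
    simp [pauliMat, hj]
  · simp

theorem pauliTensor_apply_eq_zero {w : PauliVec n} {q : Fin n} (hw : ∀ j, j ≠ q → w j = 0)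
    {x y : Fin n → Fin 2} {j : Fin n} (hj : j ≠ q) (hxy : x j ≠ y j) : pauliTensor w x y = 0 := by
  simp only [pauliTensor, qTensor, Matrix.of_apply]
  refine Finset.prod_eq_zero (Finset.mem_univ j) ?_
  rw [hw j hj, show pauliLabel.symm (0 : ZMod 2 × ZMod 2) = 0 by decide]
  simp [pauliMat, hxy]

/-- An operator that acts trivially on a qubit commutes with the Pauli operators on that qubit. -/
theorem ActsTriviallyOn.commute_pauliTensor {M : QOp n} {q : Fin n} (hM : ActsTriviallyOn M q)
    {w : PauliVec n} (hw : ∀ j, j ≠ q → w j = 0) : Commute M (pauliTensor w) := by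
  have hinj : ∀ y : Fin n → Fin 2, Function.Injective fun c => Function.update y q c :=
    fun y => Function.update_injective y q
  have hnot : ∀ y z : Fin n → Fin 2,
      z ∉ (fun c => Function.update y q c) '' ((Finset.univ : Finset (Fin 2)) : Set (Fin 2)) →
      ∃ j, j ≠ q ∧ z j ≠ y j := by
    intro y z hz
    by_contra hcon
    push Not at hcon
    refine hz ⟨z q, by simp, ?_⟩
    funext j
    by_cases hj : j = q
    · subst hj; simp
    · simp [hj, hcon j hj]
  ext x y
  set m := M (Function.update x q 0) (Function.update y q 0) with hm
  set s := pauliMat (pauliLabel.symm (w q)) with hs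
  have hMup : ∀ c, M x (Function.update y q c) = if x q = c then m else 0 := by
    intro c
    rw [hM]
    simp [hm]
  have hMup' : ∀ c, M (Function.update x q c) y = if c = y q then m else 0 := by
    intro c
    rw [hM]
    simp [hm]
  have hBup : ∀ c, pauliTensor w (Function.update y q c) y = s c (y q) := by
    intro c
    have := pauliTensor_apply_update_right hw (Function.update y q c) (y q)
    simpa using this
  have e1 : (M * pauliTensor w) x y = ∑ c, M x (Function.update y q c) * s c (y q) := by
    rw [Matrix.mul_apply]
    symm
    refine Finset.sum_of_injOn (fun c => Function.update y q c) ((hinj y).injOn) ?_ ?_ ?_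
    · exact fun _ _ => Finset.mem_coe.2 (Finset.mem_univ _)
    · intro z _ hz
      obtain ⟨j, hj, hzj⟩ := hnot y z hz
      rw [pauliTensor_apply_eq_zero hw hj hzj, mul_zero]
    · intro c _
      rw [hBup]
  have e2 : (pauliTensor w * M) x y = ∑ c, s (x q) c * M (Function.update x q c) y := by
    rw [Matrix.mul_apply]
    symm
    refine Finset.sum_of_injOn (fun c => Function.update x q c) ((hinj x).injOn) ?_ ?_ ?_
    · exact fun _ _ => Finset.mem_coe.2 (Finset.mem_univ _)
    · intro z _ hz
      obtain ⟨j, hj, hzj⟩ := hnot x z hz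
      rw [pauliTensor_apply_eq_zero hw hj hzj.symm, zero_mul]
    · intro c _
      rw [pauliTensor_apply_update_right hw]
  rw [e1, e2]
  simp only [hMup, hMup']
  simp [mul_comm]

theorem actsTriviallyOn_smul_pauliTensor (a : ℂ) {v : PauliVec n} {q : Fin n} (hv : v q = 0) :
    ActsTriviallyOn (a • pauliTensor v) q := by
  intro x y
  have hone : pauliMat (pauliLabel.symm (v q)) = 1 := by
    rw [hv, show pauliLabel.symm (0 : ZMod 2 × ZMod 2) = 0 by decide]; rfl
  simp only [pauliTensor, qTensor, Matrix.smul_apply, Matrix.of_apply]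
  split_ifs with h
  · congr 1
    refine Finset.prod_congr rfl fun j _ => ?_
    by_cases hj : j = q
    · subst hj
      rw [hone, Function.update_self, Function.update_self, h, Matrix.one_apply_eq,
        Matrix.one_apply_eq]
    · simp [hj]
  · rw [Finset.prod_eq_zero (Finset.mem_univ q), smul_zero]
    rw [hone, Matrix.one_apply_ne h]

theorem signOf_eq_one_iff {t : ZMod 2} : signOf t = 1 ↔ t = 0 := by
  unfold signOf
  split_ifs with h
  · simp [h]
  · simp only [h, iff_false]
    norm_num

theorem pauliTensor_ne_zero (v : PauliVec n) : pauliTensor v ≠ 0 :=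
  linearIndependent_pauliTensor.ne_zero v

theorem commute_pauliTensor_iff {v w : PauliVec n} :
    Commute (pauliTensor v) (pauliTensor w) ↔ pauliForm n v w = 0 := by
  have hne : pauliTensor w * pauliTensor v ≠ 0 := by
    intro h
    have := congrArg (pauliTensor w * ·) h
    simp only [← mul_assoc, pauliTensor_sq, one_mul, mul_zero] at this
    exact pauliTensor_ne_zero v this
  rw [← signOf_eq_one_iff]
  constructor
  · intro h
    have h' := pauliTensor_comm v w
    rw [h.eq] at h'
    have : (signOf (pauliForm n v w) - 1) • (pauliTensor w * pauliTensor v) = 0 := by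
      rw [sub_smul, one_smul, ← h', sub_self]
    exact sub_eq_zero.1 ((smul_eq_zero.1 this).resolve_right hne)
  · intro h
    have h' := pauliTensor_comm v w
    rwa [h, one_smul] at h'

theorem opSupport_smul_pauliTensor {a : ℂ} (ha : a ≠ 0) (v : PauliVec n) :
    opSupport (a • pauliTensor v) = {q | v q ≠ 0} := by
  ext q
  simp only [opSupport, Set.mem_ofPred_eq]
  refine not_congr ⟨fun h => ?_, fun h => actsTriviallyOn_smul_pauliTensor a h⟩
  by_contra hq
  obtain ⟨t, ht⟩ := exists_single_pauliForm hq
  refine ht (commute_pauliTensor_iff.1 ?_)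
  have := h.commute_pauliTensor (w := Pi.single q t) fun j hj => by simp [hj]
  have := this.smul_left a⁻¹
  rwa [smul_smul, inv_mul_cancel₀ ha, one_smul] at this

/-! ### The Pauli group modulo phases -/

namespace PauliOp

theorem exists_toOp_eq (P : PauliOp n) :
    ∃ (v : PauliVec n) (c : ℕ), P.toOp = Complex.I ^ c • pauliTensor v := by
  obtain ⟨c, s, h⟩ := P.2
  exact ⟨fun j => pauliLabel (s j), c, by
    simp only [pauliTensor, Equiv.symm_apply_apply]; exact h⟩

/-- The symplectic vector of a Pauli operator. -/
def vec (P : PauliOp n) : PauliVec n := P.exists_toOp_eq.choose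

theorem toOp_eq (P : PauliOp n) : ∃ c : ℕ, P.toOp = Complex.I ^ c • pauliTensor P.vec :=
  P.exists_toOp_eq.choose_spec

theorem vec_eq_of_toOp {P : PauliOp n} {v : PauliVec n} {a : ℂ} (h : P.toOp = a • pauliTensor v) :
    P.vec = v := by
  obtain ⟨c, hc⟩ := P.toOp_eq
  by_contra hne
  have h' := congrArg (fun M => (M * pauliTensor P.vec).trace) (hc.symm.trans h)
  simp only [smul_mul_assoc, Matrix.trace_smul, trace_pauliTensor_mul_self,
    trace_pauliTensor_mul_of_ne (Ne.symm hne), smul_eq_mul, mul_zero] at h'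
  have h2 : Complex.I ^ c ≠ 0 := pow_ne_zero _ Complex.I_ne_zero
  exact mul_ne_zero h2 (pow_ne_zero _ two_ne_zero) h'

theorem toOp_mul (P Q : PauliOp n) : (P * Q).toOp = P.toOp * Q.toOp := rfl

theorem toOp_injective : Function.Injective (PauliOp.toOp : PauliOp n → QOp n) := fun _ _ h =>
  Subtype.ext (Units.ext h)

theorem vec_mul (P Q : PauliOp n) : (P * Q).vec = P.vec + Q.vec := by
  obtain ⟨c, hc⟩ := P.toOp_eq
  obtain ⟨c', hc'⟩ := Q.toOp_eq
  obtain ⟨e, he⟩ := pauliTensor_mul P.vec Q.vec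
  refine vec_eq_of_toOp (a := Complex.I ^ c * Complex.I ^ c' * Complex.I ^ e) ?_
  rw [toOp_mul, hc, hc', smul_mul_smul_comm, he, smul_smul]

theorem vec_one : (1 : PauliOp n).vec = 0 :=
  vec_eq_of_toOp (a := 1) (by rw [one_smul, pauliTensor_zero]; rfl)

theorem vec_inv (P : PauliOp n) : P⁻¹.vec = P.vec := by
  rw [← pauliVec_add_eq_zero_iff, ← vec_mul, inv_mul_cancel, vec_one]

theorem mem_pauliPhases_iff {P : PauliOp n} : P ∈ pauliPhases n ↔ P.vec = 0 := by
  constructor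
  · rintro ⟨c, hc⟩
    exact vec_eq_of_toOp (a := c) (by rw [pauliTensor_zero, hc])
  · intro h
    obtain ⟨c, hc⟩ := P.toOp_eq
    exact ⟨Complex.I ^ c, by rw [hc, h, pauliTensor_zero]⟩

theorem opSupport_toOp (P : PauliOp n) : opSupport P.toOp = {q | P.vec q ≠ 0} := by
  obtain ⟨c, hc⟩ := P.toOp_eq
  rw [hc, opSupport_smul_pauliTensor (pow_ne_zero _ Complex.I_ne_zero)]

theorem commute_iff {P Q : PauliOp n} : Commute P Q ↔ pauliForm n P.vec Q.vec = 0 := by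
  obtain ⟨c, hc⟩ := P.toOp_eq
  obtain ⟨c', hc'⟩ := Q.toOp_eq
  have h1 : Commute P Q ↔ Commute P.toOp Q.toOp :=
    ⟨fun h => by
      have := congrArg PauliOp.toOp h.eq
      rwa [toOp_mul, toOp_mul] at this,
    fun h => toOp_injective (by rw [toOp_mul, toOp_mul]; exact h.eq)⟩
  have hI : ∀ c : ℕ, Complex.I ^ c ≠ 0 := fun c => pow_ne_zero _ Complex.I_ne_zero
  rw [h1, hc, hc', Commute.smul_left_iff₀ (hI c), Commute.smul_right_iff₀ (hI c'),
    commute_pauliTensor_iff]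

theorem exists_vec_eq (v : PauliVec n) : ∃ P : PauliOp n, P.vec = v ∧ P.toOp = pauliTensor v := by
  let u : (QOp n)ˣ := ⟨pauliTensor v, pauliTensor v, pauliTensor_sq v, pauliTensor_sq v⟩
  have hu : u ∈ pauliGroup n :=
    ⟨0, fun j => pauliLabel.symm (v j), by rw [pow_zero, one_smul]; rfl⟩
  have h : PauliOp.toOp ⟨u, hu⟩ = pauliTensor v := rfl
  exact ⟨⟨u, hu⟩, vec_eq_of_toOp (a := 1) (by rw [h, one_smul]), h⟩

theorem weight_eq (P : PauliOp n) : P.weight = {q | P.vec q ≠ 0}.ncard := by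
  rw [weight, opSupport_toOp]

end PauliOp

end

noncomputable section

variable {n : ℕ}

/-! ### Symplectic duality -/

/-- The symplectic complement of a space of symplectic vectors. -/
abbrev sympPerp (W : Submodule (ZMod 2) (PauliVec n)) : Submodule (ZMod 2) (PauliVec n) :=
  (pauliForm n).orthogonal W

theorem mem_sympPerp {W : Submodule (ZMod 2) (PauliVec n)} {v : PauliVec n} :
    v ∈ sympPerp W ↔ ∀ w ∈ W, pauliForm n w v = 0 := Iff.rfl

theorem sympPerp_sympPerp (W : Submodule (ZMod 2) (PauliVec n)) : sympPerp (sympPerp W) = W :=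
  LinearMap.BilinForm.orthogonal_orthogonal pauliForm_nondegenerate pauliForm_isRefl W

theorem sympPerp_anti {W W' : Submodule (ZMod 2) (PauliVec n)} (h : W ≤ W') :
    sympPerp W' ≤ sympPerp W := LinearMap.BilinForm.orthogonal_le h

theorem mem_sympPerp_span {s : Set (PauliVec n)} {v : PauliVec n} :
    v ∈ sympPerp (Submodule.span (ZMod 2) s) ↔ ∀ w ∈ s, pauliForm n w v = 0 := by
  refine ⟨fun h w hw => h w (Submodule.subset_span hw), fun h w hw => ?_⟩
  change pauliForm n w v = 0
  induction hw using Submodule.span_induction with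
  | mem w hw => exact h w hw
  | zero => simp
  | add a b _ _ ha hb => simp [ha, hb]
  | smul c a _ ha => simp [ha]

theorem sympPerp_sup (W W' : Submodule (ZMod 2) (PauliVec n)) :
    sympPerp (W ⊔ W') = sympPerp W ⊓ sympPerp W' := by
  refine le_antisymm (le_inf (sympPerp_anti le_sup_left) (sympPerp_anti le_sup_right)) ?_
  rintro v ⟨h1, h2⟩
  rw [mem_sympPerp]
  intro w hw
  obtain ⟨a, ha, b, hb, rfl⟩ := Submodule.mem_sup.1 hw
  have e1 : pauliForm n a v = 0 := h1 a ha
  have e2 : pauliForm n b v = 0 := h2 b hb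
  simp [e1, e2]

/-- The symplectic vectors supported on a set of qubits. -/
def pauliSupported (A : Finset (Fin n)) : Submodule (ZMod 2) (PauliVec n) where
  carrier := {v | ∀ q, q ∉ A → v q = 0}
  add_mem' := by
    intro a b ha hb q hq
    simp [ha q hq, hb q hq]
  zero_mem' := fun _ _ => rfl
  smul_mem' := by
    intro c a ha q hq
    simp [ha q hq]

theorem mem_pauliSupported {A : Finset (Fin n)} {v : PauliVec n} :
    v ∈ pauliSupported A ↔ ∀ q, q ∉ A → v q = 0 := Iff.rfl

theorem pauliSupported_mono {A B : Finset (Fin n)} (h : A ⊆ B) :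
    pauliSupported A ≤ pauliSupported B := fun _ hv q hq => hv q fun hA => hq (h hA)

theorem pauliForm_eq_zero_of_disjoint {v w : PauliVec n} (h : ∀ q, v q = 0 ∨ w q = 0) :
    pauliForm n v w = 0 := by
  rw [pauliForm_apply]
  refine Finset.sum_eq_zero fun q _ => ?_
  rcases h q with h | h <;> simp [h]

theorem sympPerp_pauliSupported (A : Finset (Fin n)) :
    sympPerp (pauliSupported A) = pauliSupported Aᶜ := by
  ext v
  constructor
  · intro hv q hq
    rw [Finset.mem_compl, not_not] at hq
    by_contra hne
    obtain ⟨t, ht⟩ := exists_single_pauliForm hne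
    refine ht ?_
    rw [pauliForm_comm]
    refine hv (Pi.single q t) fun j hj => ?_
    rw [Pi.single_eq_of_ne]
    rintro rfl
    exact hj hq
  · intro hv w hw
    refine pauliForm_eq_zero_of_disjoint fun q => ?_
    by_cases hq : q ∈ A
    · exact Or.inr (hv q (by simpa using hq))
    · exact Or.inl (hw q hq)

/-- The part of a symplectic vector on a set of qubits. -/
def pauliRestrict (A : Finset (Fin n)) (v : PauliVec n) : PauliVec n :=
  fun q => if q ∈ A then v q else 0

theorem pauliRestrict_mem (A : Finset (Fin n)) (v : PauliVec n) :
    pauliRestrict A v ∈ pauliSupported A := fun q hq => by simp [pauliRestrict, hq]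

theorem pauliRestrict_add {A B : Finset (Fin n)} (hAB : Disjoint A B) {v : PauliVec n}
    (hv : v ∈ pauliSupported (A ∪ B)) : pauliRestrict A v + pauliRestrict B v = v := by
  funext q
  simp only [Pi.add_apply, pauliRestrict]
  by_cases hA : q ∈ A
  · simp [hA, Finset.disjoint_left.1 hAB hA]
  · by_cases hB : q ∈ B
    · simp [hA, hB]
    · simp [hA, hB, hv q (by simp [hA, hB])]

/-- A bare operator on two decoupled sets of qubits is a product of bare operators. -/
theorem pauliRestrict_mem_sympPerp_span {s : Set (PauliVec n)} {A B : Finset (Fin n)}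
    (hAB : Disjoint A B) (hs : ∀ g ∈ s, ∀ a ∈ A, ∀ b ∈ B, g a = 0 ∨ g b = 0) {v : PauliVec n}
    (hv : v ∈ pauliSupported (A ∪ B)) (hvs : v ∈ sympPerp (Submodule.span (ZMod 2) s)) :
    pauliRestrict A v ∈ sympPerp (Submodule.span (ZMod 2) s) := by
  rw [mem_sympPerp_span] at hvs ⊢
  intro g hg
  by_cases hgA : ∀ a ∈ A, g a = 0
  · refine pauliForm_eq_zero_of_disjoint fun q => ?_
    by_cases hq : q ∈ A
    · exact Or.inl (hgA q hq)
    · exact Or.inr (by simp [pauliRestrict, hq])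
  · push Not at hgA
    obtain ⟨a, ha, hga⟩ := hgA
    have h := hvs g hg
    rw [← pauliRestrict_add hAB hv, map_add, pauliForm_eq_zero_of_disjoint (w := pauliRestrict B v),
      add_zero] at h
    · exact h
    · intro q
      by_cases hq : q ∈ B
      · exact Or.inl ((hs g hg a ha q hq).resolve_left hga)
      · exact Or.inr (by simp [pauliRestrict, hq])

/-- The cleaning lemma: if the set `T` supports no nontrivial dressed logical operator, then every
bare operator can be multiplied by a stabilizer so that it acts trivially on `T`. -/
theorem sympPerp_le_of_dressed {S G : Submodule (ZMod 2) (PauliVec n)} (hGS : G ≤ sympPerp S)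
    {T : Finset (Fin n)} (hT : pauliSupported T ⊓ sympPerp S ≤ G) :
    sympPerp G ≤ sympPerp G ⊓ pauliSupported Tᶜ ⊔ S := by
  rw [← sympPerp_sympPerp (sympPerp G ⊓ pauliSupported Tᶜ ⊔ S)]
  refine sympPerp_anti ?_
  rw [← sympPerp_pauliSupported, ← sympPerp_sup, sympPerp_sup _ S, sympPerp_sympPerp]
  rintro x ⟨hx, hxS⟩
  obtain ⟨g, hg, e, he, rfl⟩ := Submodule.mem_sup.1 hx
  refine add_mem hg (hT ⟨he, ?_⟩)
  have := sub_mem hxS (hGS hg)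
  simpa using this

/-! ### The symplectic image of a subgroup of the Pauli group -/

/-- The symplectic vectors of the elements of a subgroup of the Pauli group. -/
def vecSubmodule (H : Subgroup (PauliOp n)) : Submodule (ZMod 2) (PauliVec n) where
  carrier := {v | ∃ P ∈ H, P.vec = v}
  add_mem' := by
    rintro _ _ ⟨P, hP, rfl⟩ ⟨Q, hQ, rfl⟩
    exact ⟨P * Q, mul_mem hP hQ, P.vec_mul Q⟩
  zero_mem' := ⟨1, one_mem _, PauliOp.vec_one⟩
  smul_mem' := by
    rintro c _ ⟨P, hP, rfl⟩
    fin_cases c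
    · exact ⟨1, one_mem _, by rw [PauliOp.vec_one]; exact (zero_smul (ZMod 2) P.vec).symm⟩
    · exact ⟨P, hP, (one_smul (ZMod 2) P.vec).symm⟩

theorem vec_mem_vecSubmodule {H : Subgroup (PauliOp n)} {P : PauliOp n} (h : P ∈ H) :
    P.vec ∈ vecSubmodule H := ⟨P, h, rfl⟩

theorem vecSubmodule_closure (s : Set (PauliOp n)) :
    vecSubmodule (Subgroup.closure s) = Submodule.span (ZMod 2) (PauliOp.vec '' s) := by
  apply le_antisymm
  · rintro _ ⟨P, hP, rfl⟩
    induction hP using Subgroup.closure_induction with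
    | mem P hP => exact Submodule.subset_span ⟨P, hP, rfl⟩
    | one => rw [PauliOp.vec_one]; exact zero_mem _
    | mul P Q _ _ hP hQ => rw [PauliOp.vec_mul]; exact add_mem hP hQ
    | inv P _ hP => rwa [PauliOp.vec_inv]
  · rw [Submodule.span_le]
    rintro _ ⟨P, hP, rfl⟩
    exact vec_mem_vecSubmodule (Subgroup.subset_closure hP)

theorem vecSubmodule_sup (H K : Subgroup (PauliOp n)) :
    vecSubmodule (H ⊔ K) = vecSubmodule H ⊔ vecSubmodule K := by
  rw [Subgroup.sup_eq_closure, vecSubmodule_closure, Set.image_union, Submodule.span_union,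
    ← vecSubmodule_closure, ← vecSubmodule_closure, Subgroup.closure_eq, Subgroup.closure_eq]

theorem vecSubmodule_pauliPhases : vecSubmodule (pauliPhases n) = ⊥ := by
  rw [eq_bot_iff]
  rintro _ ⟨P, hP, rfl⟩
  exact PauliOp.mem_pauliPhases_iff.1 hP

theorem vec_mem_vecSubmodule_iff {H : Subgroup (PauliOp n)} (hH : pauliPhases n ≤ H)
    {P : PauliOp n} : P.vec ∈ vecSubmodule H ↔ P ∈ H := by
  refine ⟨?_, vec_mem_vecSubmodule⟩
  rintro ⟨Q, hQ, hQP⟩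
  have : P * Q⁻¹ ∈ H := hH <| PauliOp.mem_pauliPhases_iff.2 <| by
    rw [PauliOp.vec_mul, PauliOp.vec_inv, hQP, pauliVec_add_self]
  simpa using mul_mem this hQ

theorem mem_centralizer_iff_vec {H : Subgroup (PauliOp n)} {P : PauliOp n} :
    P ∈ Subgroup.centralizer (H : Set (PauliOp n)) ↔ P.vec ∈ sympPerp (vecSubmodule H) := by
  rw [Subgroup.mem_centralizer_iff, mem_sympPerp]
  constructor
  · rintro h _ ⟨Q, hQ, rfl⟩
    exact PauliOp.commute_iff.1 (h Q hQ)
  · intro h Q hQ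
    exact PauliOp.commute_iff.2 (h _ (vec_mem_vecSubmodule hQ))

namespace SubsystemCode

variable {k g : ℕ} (C : SubsystemCode n k g)

/-! ### Correctable sets of a subsystem code -/

/-- The symplectic vectors of the stabilizer group. -/
def stabVec : Submodule (ZMod 2) (PauliVec n) := vecSubmodule C.stabilizerGroup

/-- The symplectic vectors of the gauge group. -/
def gaugeVec : Submodule (ZMod 2) (PauliVec n) := vecSubmodule C.gaugeGroup

theorem stabVec_eq : C.stabVec = Submodule.span (ZMod 2) (Set.range fun i => (C.stab i).vec) := by
  rw [stabVec, stabilizerGroup, vecSubmodule_closure, ← Set.range_comp]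
  rfl

theorem gaugeVec_eq : C.gaugeVec = C.stabVec ⊔
    Submodule.span (ZMod 2) (Set.range fun j => (C.logX (Fin.natAdd k j)).vec) ⊔
    Submodule.span (ZMod 2) (Set.range fun j => (C.logZ (Fin.natAdd k j)).vec) := by
  rw [gaugeVec, gaugeGroup, vecSubmodule_sup, vecSubmodule_sup, vecSubmodule_sup,
    vecSubmodule_pauliPhases, sup_bot_eq, vecSubmodule_closure, vecSubmodule_closure,
    ← Set.range_comp, ← Set.range_comp]
  rfl

theorem stabVec_le_gaugeVec : C.stabVec ≤ C.gaugeVec := by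
  rw [gaugeVec_eq]
  exact le_sup_left.trans le_sup_left

theorem pauliForm_logX_logX (i j) : pauliForm n (C.logX i).vec (C.logX j).vec = 0 :=
  PauliOp.commute_iff.1 (C.logX_comm i j)

theorem pauliForm_logZ_logZ (i j) : pauliForm n (C.logZ i).vec (C.logZ j).vec = 0 :=
  PauliOp.commute_iff.1 (C.logZ_comm i j)

theorem pauliForm_logX_logZ (i j) :
    pauliForm n (C.logX i).vec (C.logZ j).vec = if i = j then 1 else 0 := by
  split_ifs with h
  · subst h
    have hne : pauliForm n (C.logX i).vec (C.logZ i).vec ≠ 0 := by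
      intro h0
      have hc := PauliOp.commute_iff.2 h0
      have ha := C.logX_logZ_anticomm i
      rw [hc.eq] at ha
      have hz := eq_neg_iff_add_eq_zero.1 ha
      rw [← two_smul ℂ, smul_eq_zero, or_iff_right two_ne_zero] at hz
      obtain ⟨c, hc'⟩ := (C.logZ i * C.logX i).toOp_eq
      rw [hz] at hc'
      exact smul_ne_zero (pow_ne_zero _ Complex.I_ne_zero) (pauliTensor_ne_zero _) hc'.symm
    generalize pauliForm n (C.logX i).vec (C.logZ i).vec = t at hne
    revert t
    decide
  · exact PauliOp.commute_iff.1 (C.logX_logZ_comm i j h)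

theorem pauliForm_stabVec_logX {s : PauliVec n} (hs : s ∈ C.stabVec) (i) :
    pauliForm n s (C.logX i).vec = 0 := by
  rw [stabVec_eq] at hs
  refine (mem_sympPerp_span.2 ?_ : (C.logX i).vec ∈ sympPerp _) s hs
  rintro _ ⟨j, rfl⟩
  exact PauliOp.commute_iff.1 (C.logX_stab i j).symm

theorem pauliForm_stabVec_logZ {s : PauliVec n} (hs : s ∈ C.stabVec) (i) :
    pauliForm n s (C.logZ i).vec = 0 := by
  rw [stabVec_eq] at hs
  refine (mem_sympPerp_span.2 ?_ : (C.logZ i).vec ∈ sympPerp _) s hs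
  rintro _ ⟨j, rfl⟩
  exact PauliOp.commute_iff.1 (C.logZ_stab i j).symm

theorem gaugeVec_le_sympPerp_stabVec : C.gaugeVec ≤ sympPerp C.stabVec := by
  rw [gaugeVec_eq, sup_le_iff, sup_le_iff]
  refine ⟨⟨?_, ?_⟩, ?_⟩
  · conv_lhs => rw [stabVec_eq]
    rw [Submodule.span_le]
    rintro _ ⟨i, rfl⟩
    rw [stabVec_eq]
    refine mem_sympPerp_span.2 ?_
    rintro _ ⟨j, rfl⟩
    exact PauliOp.commute_iff.1 (C.stab_comm j i)
  · rw [Submodule.span_le]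
    rintro _ ⟨i, rfl⟩ s hs
    exact C.pauliForm_stabVec_logX hs _
  · rw [Submodule.span_le]
    rintro _ ⟨i, rfl⟩ s hs
    exact C.pauliForm_stabVec_logZ hs _

/-- The centre of the gauge group consists of the stabilizers, up to phases. -/
theorem gaugeVec_inf_sympPerp_le : C.gaugeVec ⊓ sympPerp C.gaugeVec ≤ C.stabVec := by
  rintro x ⟨hx, hxG⟩
  have hXG : ∀ j : Fin g, (C.logX (Fin.natAdd k j)).vec ∈ C.gaugeVec := fun j => by
    rw [gaugeVec_eq]
    exact Submodule.mem_sup_left (Submodule.mem_sup_right (Submodule.subset_span ⟨j, rfl⟩))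
  have hZG : ∀ j : Fin g, (C.logZ (Fin.natAdd k j)).vec ∈ C.gaugeVec := fun j => by
    rw [gaugeVec_eq]
    exact Submodule.mem_sup_right (Submodule.subset_span ⟨j, rfl⟩)
  rw [gaugeVec_eq] at hx
  obtain ⟨y, hy, b, hb, rfl⟩ := Submodule.mem_sup.1 hx
  obtain ⟨s, hs, a, ha, rfl⟩ := Submodule.mem_sup.1 hy
  obtain ⟨α, rfl⟩ := (Submodule.mem_span_range_iff_exists_fun _).1 ha
  obtain ⟨β, rfl⟩ := (Submodule.mem_span_range_iff_exists_fun _).1 hb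
  have hα : ∀ j, α j = 0 := by
    intro j
    have h : pauliForm n _ _ = 0 := hxG _ (hZG j)
    rw [pauliForm_comm] at h
    simpa [C.pauliForm_stabVec_logZ hs, pauliForm_logX_logZ, pauliForm_logZ_logZ] using h
  have hβ : ∀ j, β j = 0 := by
    intro j
    have h : pauliForm n _ _ = 0 := hxG _ (hXG j)
    rw [pauliForm_comm] at h
    have hzx : ∀ i j, pauliForm n (C.logZ i).vec (C.logX j).vec = if j = i then 1 else 0 :=
      fun i j => by rw [pauliForm_comm, pauliForm_logX_logZ]
    simpa [C.pauliForm_stabVec_logX hs, pauliForm_logX_logX, hzx] using h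
  simpa [hα, hβ] using hs

/-- The bare logical operators of the encoded qubits commute with the gauge group. -/
theorem logX_vec_mem_sympPerp_gaugeVec (i : Fin k) :
    (C.logX (Fin.castAdd g i)).vec ∈ sympPerp C.gaugeVec := by
  have hne : ∀ j : Fin g, ¬ Fin.castAdd g i = Fin.natAdd k j := fun j h => by
    have := congrArg Fin.val h
    simp at this
    omega
  rw [gaugeVec_eq, sympPerp_sup, sympPerp_sup]
  refine ⟨⟨fun s hs => C.pauliForm_stabVec_logX hs _, ?_⟩, ?_⟩
  · refine mem_sympPerp_span.2 ?_
    rintro _ ⟨j, rfl⟩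
    exact C.pauliForm_logX_logX _ _
  · refine mem_sympPerp_span.2 ?_
    rintro _ ⟨j, rfl⟩
    rw [pauliForm_comm, pauliForm_logX_logZ, if_neg (hne j)]

theorem logZ_vec_mem_sympPerp_gaugeVec (i : Fin k) :
    (C.logZ (Fin.castAdd g i)).vec ∈ sympPerp C.gaugeVec := by
  have hne : ∀ j : Fin g, ¬ Fin.natAdd k j = Fin.castAdd g i := fun j h => by
    have := congrArg Fin.val h
    simp at this
    omega
  rw [gaugeVec_eq, sympPerp_sup, sympPerp_sup]
  refine ⟨⟨fun s hs => C.pauliForm_stabVec_logZ hs _, ?_⟩, ?_⟩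
  · refine mem_sympPerp_span.2 ?_
    rintro _ ⟨j, rfl⟩
    rw [pauliForm_logX_logZ, if_neg (hne j)]
  · refine mem_sympPerp_span.2 ?_
    rintro _ ⟨j, rfl⟩
    exact C.pauliForm_logZ_logZ _ _

/-- If `A` supports no nontrivial bare logical operator, then all logical operators can be moved to
the complement of `A` by gauge operators, so the complement has at least `k` qubits. -/
theorem dim_le_card_compl {A : Finset (Fin n)}
    (hA : pauliSupported A ⊓ sympPerp C.gaugeVec ≤ C.stabVec) : k ≤ Aᶜ.card := by
  have hle : sympPerp C.stabVec ≤ pauliSupported Aᶜ ⊔ C.gaugeVec := by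
    have := sympPerp_anti hA
    rwa [← sympPerp_sympPerp (pauliSupported A), sympPerp_pauliSupported, ← sympPerp_sup,
      sympPerp_sympPerp] at this
  have hex : ∀ i : Fin k ⊕ Fin k, ∃ e ∈ pauliSupported Aᶜ, ∃ y ∈ C.gaugeVec,
      e + y = Sum.elim (fun i => (C.logX (Fin.castAdd g i)).vec)
        (fun i => (C.logZ (Fin.castAdd g i)).vec) i := by
    intro i
    refine Submodule.mem_sup.1 (hle ?_)
    rcases i with i | i
    · exact fun s hs => C.pauliForm_stabVec_logX hs _
    · exact fun s hs => C.pauliForm_stabVec_logZ hs _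
  choose e he y hy hey using hex
  have hey' : ∀ i, e i = Sum.elim (fun i => (C.logX (Fin.castAdd g i)).vec)
        (fun i => (C.logZ (Fin.castAdd g i)).vec) i - y i := fun i => by rw [← hey i]; simp
  let r : PauliVec n →ₗ[ZMod 2] ({q // q ∈ Aᶜ} → ZMod 2 × ZMod 2) :=
    LinearMap.pi fun q => LinearMap.proj q.1
  have hli : LinearIndependent (ZMod 2) fun i => r (e i) := by
    rw [Fintype.linearIndependent_iff]
    intro c hc
    have hx : ∑ i, c i • e i = 0 := by
      have hsup : ∑ i, c i • e i ∈ pauliSupported Aᶜ :=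
        Submodule.sum_mem _ fun i _ => Submodule.smul_mem _ _ (he i)
      have hr : r (∑ i, c i • e i) = 0 := by rw [map_sum, ← hc]; simp
      funext q
      by_cases hq : q ∈ Aᶜ
      · exact congrFun hr ⟨q, hq⟩
      · exact hsup q hq
    have hform : ∀ w ∈ sympPerp C.gaugeVec, ∑ i, c i * pauliForm n (Sum.elim
        (fun i => (C.logX (Fin.castAdd g i)).vec) (fun i => (C.logZ (Fin.castAdd g i)).vec) i) w
        = 0 := by
      intro w hw
      have h := congrArg (fun v => pauliForm n v w) hx
      simp only [hey', map_sum, map_smul, map_sub, LinearMap.sum_apply, LinearMap.smul_apply,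
        LinearMap.sub_apply, smul_eq_mul, map_zero, LinearMap.zero_apply] at h
      rw [← h]
      refine Finset.sum_congr rfl fun i _ => ?_
      rw [show pauliForm n (y i) w = 0 from hw _ (hy i), sub_zero]
    rintro (j | j)
    · have h := hform _ (C.logZ_vec_mem_sympPerp_gaugeVec j)
      simpa [pauliForm_logX_logZ, pauliForm_logZ_logZ] using h
    · have h := hform _ (C.logX_vec_mem_sympPerp_gaugeVec j)
      have hzx : ∀ i j, pauliForm n (C.logZ i).vec (C.logX j).vec = if j = i then 1 else 0 :=
        fun i j => by rw [pauliForm_comm, pauliForm_logX_logZ]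
      simpa [hzx, pauliForm_logX_logX] using h
  have hcard := hli.fintype_card_le_finrank
  simp [Module.finrank_pi_fintype, Module.finrank_prod] at hcard
  omega

theorem pauliPhases_le_gaugeGroup : pauliPhases n ≤ C.gaugeGroup := le_sup_right

theorem isDressedLogical_iff {P : PauliOp n} :
    C.IsDressedLogical P ↔ P.vec ∈ sympPerp C.stabVec ∧ P.vec ∉ C.gaugeVec := by
  rw [IsDressedLogical, mem_centralizer_iff_vec, gaugeVec,
    vec_mem_vecSubmodule_iff C.pauliPhases_le_gaugeGroup]
  rfl

theorem gaugeVec_eq_span {m : ℕ} {G : Fin m → PauliOp n} (hG : C.IsGaugeGenerators G) :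
    C.gaugeVec = Submodule.span (ZMod 2) (Set.range fun i => (G i).vec) := by
  rw [gaugeVec, ← hG, vecSubmodule_sup, vecSubmodule_pauliPhases, sup_bot_eq, vecSubmodule_closure,
    ← Set.range_comp]
  rfl

theorem HasDistance.pos {C : SubsystemCode n k g} {d : ℕ} (hd : C.HasDistance d) : 0 < d := by
  rw [Nat.pos_iff_ne_zero]
  rintro rfl
  obtain ⟨P, hP, hw⟩ := hd.1
  rw [PauliOp.weight_eq, Set.ncard_eq_zero] at hw
  refine hP.2 (C.pauliPhases_le_gaugeGroup (PauliOp.mem_pauliPhases_iff.2 (funext fun q => ?_)))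
  by_contra hq
  exact (Set.eq_empty_iff_forall_notMem.1 hw q) hq

theorem HasDistance.le {C : SubsystemCode n k g} {d : ℕ} (hd : C.HasDistance d) : d ≤ n := by
  obtain ⟨P, -, hw⟩ := hd.1
  rw [← hw, PauliOp.weight]
  exact (Set.ncard_le_card _).trans_eq (by simp)

theorem vec_eq_zero_or_of_not_interacts {m : ℕ} {G : Fin m → PauliOp n} {u v : Fin n} (huv : u ≠ v)
    (h : ¬ Interacts (Set.range fun i => (G i).toOp) u v) (i : Fin m) :
    (G i).vec u = 0 ∨ (G i).vec v = 0 := by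
  by_contra hcon
  push Not at hcon
  refine h ⟨huv, _, ⟨i, rfl⟩, ?_, ?_⟩
  · rw [PauliOp.opSupport_toOp]; exact hcon.1
  · rw [PauliOp.opSupport_toOp]; exact hcon.2

/-- The correctable sets of a subsystem code. -/
def correctableSets {m d : ℕ} {G : Fin m → PauliOp n} (hd : C.HasDistance d)
    (hG : C.IsGaugeGenerators G) :
    CorrectableSets (Interacts (Set.range fun i => (G i).toOp)) d where
  Bare A := pauliSupported A ⊓ sympPerp C.gaugeVec ≤ C.stabVec
  Dressed A := pauliSupported A ⊓ sympPerp C.stabVec ≤ C.gaugeVec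
  pos := hd.pos
  bare_mono hAB hB := (inf_le_inf_right _ (pauliSupported_mono hAB)).trans hB
  bare_of_dressed := by
    rintro A hA x ⟨hx, hxG⟩
    exact C.gaugeVec_inf_sympPerp_le ⟨hA ⟨hx, sympPerp_anti C.stabVec_le_gaugeVec hxG⟩, hxG⟩
  dressed_of_card_lt := by
    rintro A hA x ⟨hx, hxS⟩
    by_contra hxG
    obtain ⟨P, rfl, -⟩ := PauliOp.exists_vec_eq x
    have h := hd.2 ⟨P, C.isDressedLogical_iff.2 ⟨hxS, hxG⟩, rfl⟩
    have hsub : {q | P.vec q ≠ 0} ⊆ (A : Set (Fin n)) := fun q hq => by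
      by_contra hqA
      exact hq (hx q hqA)
    have := Set.ncard_le_ncard hsub
    rw [Set.ncard_coe_finset, ← PauliOp.weight_eq] at this
    omega
  bare_union := by
    rintro A B hA hB hAB hadj x ⟨hx, hxG⟩
    have hxA : pauliRestrict A x ∈ sympPerp C.gaugeVec := by
      rw [C.gaugeVec_eq_span hG] at hxG ⊢
      refine pauliRestrict_mem_sympPerp_span hAB ?_ hx hxG
      rintro _ ⟨i, rfl⟩ a ha b hb
      exact vec_eq_zero_or_of_not_interacts (u := a) (v := b) (fun h => Finset.disjoint_left.1 hAB ha (h ▸ hb))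
        (hadj a ha b hb) i
    have hadd := pauliRestrict_add hAB hx
    have hxB : pauliRestrict B x ∈ sympPerp C.gaugeVec := by
      have := sub_mem hxG hxA
      nth_rw 1 [← hadd] at this
      simpa using this
    rw [← hadd]
    exact add_mem (hA ⟨pauliRestrict_mem A x, hxA⟩) (hB ⟨pauliRestrict_mem B x, hxB⟩)
  dressed_union := by
    rintro W T hW hT hWT hadj P ⟨hP, hPS⟩
    rw [← sympPerp_sympPerp C.gaugeVec, mem_sympPerp]
    intro x hx
    obtain ⟨y, ⟨hyG, hyT⟩, s, hs, rfl⟩ := Submodule.mem_sup.1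
      (sympPerp_le_of_dressed C.gaugeVec_le_sympPerp_stabVec hT hx)
    have hdisj : Disjoint W (W ∪ T)ᶜ :=
      disjoint_compl_right.mono_left Finset.subset_union_left
    have hy : y ∈ pauliSupported (W ∪ (W ∪ T)ᶜ) := by
      refine pauliSupported_mono ?_ hyT
      intro q hq
      by_cases hqW : q ∈ W
      · exact Finset.mem_union_left _ hqW
      · refine Finset.mem_union_right _ ?_
        rw [Finset.mem_compl] at hq ⊢
        simp [hqW, hq]
    have hyW : pauliRestrict W y ∈ sympPerp C.gaugeVec := by
      rw [C.gaugeVec_eq_span hG] at hyG ⊢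
      refine pauliRestrict_mem_sympPerp_span hdisj ?_ hy hyG
      rintro _ ⟨i, rfl⟩ a ha b hb
      rw [Finset.mem_compl] at hb
      exact vec_eq_zero_or_of_not_interacts (u := a) (v := b) (fun h => hb (h ▸ Finset.mem_union_left _ ha))
        (hadj a ha b hb) i
    have h1 : pauliForm n s P = 0 := hPS s hs
    have h2 : pauliForm n (pauliRestrict W y) P = 0 := hPS _ (hW ⟨pauliRestrict_mem W y, hyW⟩)
    have h3 : pauliForm n (pauliRestrict (W ∪ T)ᶜ y) P = 0 := by
      refine pauliForm_eq_zero_of_disjoint fun q => ?_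
      by_cases hq : q ∈ W ∪ T
      · exact Or.inl (by simp only [pauliRestrict, Finset.mem_compl, hq, not_true, if_false])
      · exact Or.inr (hP q hq)
    rw [← pauliRestrict_add hdisj hy]
    simp only [map_add, LinearMap.add_apply, h1, h2, h3, add_zero]

end SubsystemCode

end

noncomputable section

variable {n : ℕ}

/-! ### Local operators -/

/-- The operators that act on the qubits in `A` only, as the span of the Pauli operators supported
on `A`. -/
def opsOn (A : Finset (Fin n)) : Submodule ℂ (QOp n) :=
  Submodule.span ℂ (pauliTensor '' (pauliSupported A : Set (PauliVec n)))

theorem pauliTensor_mem_opsOn {A : Finset (Fin n)} {v : PauliVec n} (h : v ∈ pauliSupported A) :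
    pauliTensor v ∈ opsOn A := Submodule.subset_span ⟨v, h, rfl⟩

theorem opsOn_mono {A B : Finset (Fin n)} (h : A ⊆ B) : opsOn A ≤ opsOn B :=
  Submodule.span_mono (Set.image_mono (pauliSupported_mono h))

theorem opsOn_induction {A : Finset (Fin n)} {q : QOp n → Prop}
    (pauli : ∀ v ∈ pauliSupported A, q (pauliTensor v)) (zero : q 0)
    (add : ∀ X Y, q X → q Y → q (X + Y)) (smul : ∀ (c : ℂ) X, q X → q (c • X))
    {X : QOp n} (hX : X ∈ opsOn A) : q X := by
  induction hX using Submodule.span_induction with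
  | mem X h => obtain ⟨v, hv, rfl⟩ := h; exact pauli v hv
  | zero => exact zero
  | add X Y _ _ hX hY => exact add X Y hX hY
  | smul c X _ hX => exact smul c X hX

theorem mul_mem_opsOn {A : Finset (Fin n)} {X Y : QOp n} (hX : X ∈ opsOn A) (hY : Y ∈ opsOn A) :
    X * Y ∈ opsOn A := by
  refine opsOn_induction (q := fun X => X * Y ∈ opsOn A) (fun v hv => ?_) (by simp)
    (fun X X' h h' => by rw [add_mul]; exact add_mem h h')
    (fun c X h => by rw [smul_mul_assoc]; exact Submodule.smul_mem _ _ h) hX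
  refine opsOn_induction (q := fun Y => pauliTensor v * Y ∈ opsOn A) (fun w hw => ?_) (by simp)
    (fun X X' h h' => by rw [mul_add]; exact add_mem h h')
    (fun c X h => by rw [mul_smul_comm]; exact Submodule.smul_mem _ _ h) hY
  obtain ⟨c, hc⟩ := pauliTensor_mul v w
  rw [hc]
  exact Submodule.smul_mem _ _ (pauliTensor_mem_opsOn (add_mem hv hw))

theorem pauliTensor_star (v : PauliVec n) : star (pauliTensor v) = pauliTensor v :=
  pauliTensor_conjTranspose v

theorem star_mem_opsOn {A : Finset (Fin n)} {X : QOp n} (hX : X ∈ opsOn A) : star X ∈ opsOn A := by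
  refine opsOn_induction (q := fun X => star X ∈ opsOn A) (fun v hv => ?_) (by simp)
    (fun X Y h h' => by rw [star_add]; exact add_mem h h')
    (fun c X h => by rw [star_smul]; exact Submodule.smul_mem _ _ h) hX
  rw [pauliTensor_star]
  exact pauliTensor_mem_opsOn hv

theorem one_mem_opsOn (A : Finset (Fin n)) : (1 : QOp n) ∈ opsOn A := by
  rw [← pauliTensor_zero]
  exact pauliTensor_mem_opsOn (zero_mem _)

theorem commute_of_mem_opsOn {A B : Finset (Fin n)} (hAB : Disjoint A B) {X Y : QOp n}
    (hX : X ∈ opsOn A) (hY : Y ∈ opsOn B) : Commute X Y := by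
  refine opsOn_induction (q := fun X => Commute X Y) (fun v hv => ?_) (Commute.zero_left _)
    (fun _ _ => Commute.add_left) (fun c _ h => h.smul_left c) hX
  refine opsOn_induction (q := fun Y => Commute (pauliTensor v) Y) (fun w hw => ?_)
    (Commute.zero_right _) (fun _ _ => Commute.add_right) (fun c _ h => h.smul_right c) hY
  refine commute_pauliTensor_iff.2 (pauliForm_eq_zero_of_disjoint fun q => ?_)
  by_cases hq : q ∈ A
  · exact Or.inr (hw q (Finset.disjoint_left.1 hAB hq))
  · exact Or.inl (hv q hq)

/-- Operators on a disjoint union of sets of qubits are sums of products of local operators. -/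
theorem exists_sum_mul_of_mem_opsOn {A B : Finset (Fin n)} (hAB : Disjoint A B) {X : QOp n}
    (hX : X ∈ opsOn (A ∪ B)) : ∃ a b : PauliVec n → QOp n, (∀ v, a v ∈ opsOn A) ∧
      (∀ v, b v ∈ opsOn B) ∧ X = ∑ v, a v * b v := by
  suffices h : ∃ b : PauliVec n → QOp n, (∀ v, b v ∈ opsOn B) ∧
      X = ∑ v, pauliTensor (pauliRestrict A v) * b v by
    obtain ⟨b, hb, hX⟩ := h
    exact ⟨_, b, fun v => pauliTensor_mem_opsOn (pauliRestrict_mem A v), hb, hX⟩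
  refine opsOn_induction (q := fun X => ∃ b : PauliVec n → QOp n, (∀ v, b v ∈ opsOn B) ∧
      X = ∑ v, pauliTensor (pauliRestrict A v) * b v) (fun w hw => ?_) ?_ ?_ ?_ hX
  · obtain ⟨c, hc⟩ := pauliTensor_mul (pauliRestrict A w) (pauliRestrict B w)
    rw [pauliRestrict_add hAB hw] at hc
    refine ⟨Pi.single w ((Complex.I ^ c)⁻¹ • pauliTensor (pauliRestrict B w)), fun v => ?_, ?_⟩
    · by_cases hv : v = w
      · subst hv
        rw [Pi.single_eq_same]
        exact Submodule.smul_mem _ _ (pauliTensor_mem_opsOn (pauliRestrict_mem B v))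
      · rw [Pi.single_eq_of_ne hv]
        exact zero_mem _
    · rw [Finset.sum_eq_single w (fun v _ hv => by rw [Pi.single_eq_of_ne hv, mul_zero]) (by simp),
        Pi.single_eq_same, mul_smul_comm, hc, smul_smul,
        inv_mul_cancel₀ (pow_ne_zero _ Complex.I_ne_zero), one_smul]
  · exact ⟨0, fun _ => zero_mem _, by simp⟩
  · rintro X Y ⟨b, hb, rfl⟩ ⟨b', hb', rfl⟩
    exact ⟨b + b', fun v => add_mem (hb v) (hb' v), by simp [mul_add, Finset.sum_add_distrib]⟩
  · rintro c X ⟨b, hb, rfl⟩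
    exact ⟨c • b, fun v => Submodule.smul_mem _ _ (hb v), by simp [Finset.smul_sum]⟩

/-- The commutant of the operators on `T` consists of the operators on the complement of `T`. -/
theorem mem_opsOn_compl {T : Finset (Fin n)} {X : QOp n}
    (hX : ∀ q ∈ T, ∀ t, Commute X (pauliTensor (Pi.single q t))) : X ∈ opsOn Tᶜ := by
  have hsum := (pauliBasis n).sum_repr X
  rw [← hsum]
  refine Submodule.sum_mem _ fun v _ => ?_
  rw [pauliBasis_apply]
  by_cases hv : v ∈ pauliSupported Tᶜ
  · exact Submodule.smul_mem _ _ (pauliTensor_mem_opsOn hv)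
  suffices h : (pauliBasis n).repr X v = 0 by rw [h, zero_smul]; exact zero_mem _
  have htr : (pauliTensor v * X).trace = (pauliBasis n).repr X v * 2 ^ n := by
    conv_lhs => rw [← hsum]
    simp only [pauliBasis_apply, Finset.mul_sum, mul_smul_comm, Matrix.trace_sum,
      Matrix.trace_smul]
    rw [Finset.sum_eq_single v (fun w _ hw => by
      rw [trace_pauliTensor_mul_of_ne (Ne.symm hw), smul_zero]) (by simp),
      trace_pauliTensor_mul_self, smul_eq_mul]
  rw [mem_pauliSupported] at hv
  push Not at hv
  obtain ⟨q, hq, hvq⟩ := hv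
  obtain ⟨t, ht⟩ := exists_single_pauliForm hvq
  set w : PauliVec n := Pi.single q t
  have hw : Commute X (pauliTensor w) := hX q (by simpa using hq) t
  have hsgn : signOf (pauliForm n v w) = -1 := by rw [signOf, if_neg ht]
  have h1 : (pauliTensor v * X).trace = -(pauliTensor v * X).trace := by
    calc (pauliTensor v * X).trace
        = (pauliTensor v * (pauliTensor w * pauliTensor w) * X).trace := by
          rw [pauliTensor_sq, mul_one]
      _ = (pauliTensor v * pauliTensor w * (X * pauliTensor w)).trace := by
          rw [hw.eq]; simp only [mul_assoc]
      _ = -(pauliTensor w * (pauliTensor v * X * pauliTensor w)).trace := by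
          rw [pauliTensor_comm v w, hsgn, neg_smul, one_smul, neg_mul, Matrix.trace_neg]
          simp only [mul_assoc]
      _ = -(pauliTensor v * X).trace := by
          rw [Matrix.trace_mul_comm, mul_assoc, pauliTensor_sq, mul_one]
  rw [self_eq_neg, htr] at h1
  exact (mul_eq_zero.1 h1).resolve_right (pow_ne_zero _ two_ne_zero)

theorem mem_opsOn_compl_of_opSupport {T : Finset (Fin n)} {M : QOp n}
    (hM : ∀ q ∈ T, q ∉ opSupport M) : M ∈ opsOn Tᶜ := by
  refine mem_opsOn_compl fun q hq t => ?_
  have h := hM q hq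
  rw [opSupport, Set.mem_ofPred_eq, not_not] at h
  exact h.commute_pauliTensor fun j hj => by simp [hj]

/-! ### The Knill–Laflamme condition -/

/-- `p` is a nonzero orthogonal projection, the projection onto a code space. -/
structure IsCodeProjection (p : QOp n) : Prop where
  star_eq : star p = p
  mul_self : p * p = p
  ne_zero : p ≠ 0

/-- The Knill–Laflamme condition for the correctability of the erasure of `A`: the compression to
the code space of every operator on `A` is a scalar. -/
def KnillLaflamme (p : QOp n) (A : Finset (Fin n)) : Prop :=
  ∀ X ∈ opsOn A, ∃ c : ℂ, p * X * p = c • p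

theorem KnillLaflamme.mono {p : QOp n} {A B : Finset (Fin n)} (h : A ⊆ B)
    (hB : KnillLaflamme p B) : KnillLaflamme p A := fun X hX => hB X (opsOn_mono h hX)

theorem KnillLaflamme.of_pauliTensor {p : QOp n} {A : Finset (Fin n)}
    (h : ∀ v ∈ pauliSupported A, ∃ c : ℂ, p * pauliTensor v * p = c • p) : KnillLaflamme p A := by
  intro X hX
  refine opsOn_induction (q := fun X => ∃ c : ℂ, p * X * p = c • p) h ⟨0, by simp⟩ ?_ ?_ hX
  · rintro X Y ⟨c, hc⟩ ⟨c', hc'⟩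
    exact ⟨c + c', by rw [mul_add, add_mul, hc, hc', add_smul]⟩
  · rintro a X ⟨c, hc⟩
    exact ⟨a * c, by rw [mul_smul_comm, smul_mul_assoc, hc, smul_smul]⟩

open scoped ComplexOrder in
theorem eq_zero_of_star_mul_self {X : QOp n} (h : star X * X = 0) : X = 0 :=
  Matrix.conjTranspose_mul_self_eq_zero.1 h

/-- The expectation value of an operator in the maximally mixed state of the code. -/
def codeExpectation (p : QOp n) : QOp n →ₗ[ℂ] ℂ where
  toFun X := (p * X * p).trace / p.trace
  map_add' X Y := by rw [mul_add, add_mul, Matrix.trace_add, add_div]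
  map_smul' c X := by
    rw [mul_smul_comm, smul_mul_assoc, Matrix.trace_smul, smul_eq_mul, mul_div_assoc]; rfl

theorem codeExpectation_apply (p X : QOp n) :
    codeExpectation p X = (p * X * p).trace / p.trace := rfl

namespace IsCodeProjection

variable {p : QOp n}

open scoped ComplexOrder in
theorem trace_ne_zero (hp : IsCodeProjection p) : p.trace ≠ 0 := by
  intro h
  refine hp.ne_zero (Matrix.trace_conjTranspose_mul_self_eq_zero_iff.1 ?_)
  rw [← Matrix.star_eq_conjTranspose, hp.star_eq, hp.mul_self, h]

theorem codeExpectation_star (hp : IsCodeProjection p) (X : QOp n) :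
    codeExpectation p (star X) = star (codeExpectation p X) := by
  have h1 : star (p * X * p) = p * star X * p := by
    rw [star_mul, star_mul, hp.star_eq, mul_assoc]
  rw [codeExpectation_apply, codeExpectation_apply, star_div₀, ← Matrix.trace_conjTranspose,
    ← Matrix.trace_conjTranspose, ← Matrix.star_eq_conjTranspose, ← Matrix.star_eq_conjTranspose,
    h1, hp.star_eq]

theorem compress_eq (hp : IsCodeProjection p) {A : Finset (Fin n)} (hA : KnillLaflamme p A)
    {X : QOp n} (hX : X ∈ opsOn A) :
    p * X * p = codeExpectation p X • p := by
  obtain ⟨c, hc⟩ := hA X hX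
  rw [codeExpectation_apply, hc, Matrix.trace_smul, smul_eq_mul,
    mul_div_cancel_right₀ _ hp.trace_ne_zero]

end IsCodeProjection

/-- Two decoupled correctable sets are correctable together. -/
theorem KnillLaflamme.union {p : QOp n} {U V : Finset (Fin n)} (hUV : Disjoint U V)
    (hdec : ∀ a ∈ opsOn U, ∀ b ∈ opsOn V, p * (a * b) * p = p * a * p * b * p)
    (hU : KnillLaflamme p U) (hV : KnillLaflamme p V) : KnillLaflamme p (U ∪ V) := by
  intro X hX
  obtain ⟨a, b, ha, hb, rfl⟩ := exists_sum_mul_of_mem_opsOn hUV hX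
  choose c hc using fun v => hU (a v) (ha v)
  choose c' hc' using fun v => hV (b v) (hb v)
  refine ⟨∑ v, c v * c' v, ?_⟩
  rw [Finset.mul_sum, Finset.sum_mul, Finset.sum_smul]
  refine Finset.sum_congr rfl fun v _ => ?_
  rw [hdec _ (ha v) _ (hb v), hc, smul_mul_assoc, smul_mul_assoc, hc', smul_smul]

/-! ### Recovery from an erasure -/

theorem exists_pseudoinverse {ι : Type*} [Fintype ι] [DecidableEq ι] {σ : Matrix ι ι ℂ}
    (hσ : σ.IsHermitian) :
    ∃ s : Matrix ι ι ℂ, σ * s * σ = σ ∧ ∀ X, Commute X σ → Commute X s := by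
  have hsa : IsSelfAdjoint σ := hσ
  have hfin : (spectrum ℝ σ).Finite := Matrix.finite_real_spectrum
  have hc : ∀ f : ℝ → ℝ, ContinuousOn f (spectrum ℝ σ) := fun f => hfin.continuousOn f
  -- with the convention `0⁻¹ = 0`, the inverse function gives the pseudoinverse
  refine ⟨cfc (fun x : ℝ => x⁻¹) σ, ?_, fun X hX => (hsa.commute_cfc hX.symm _).symm⟩
  have h : σ * cfc (fun x : ℝ => x⁻¹) σ * σ = cfc (fun x : ℝ => x * x⁻¹ * x) σ := by
    rw [cfc_mul _ _ σ (hc _) (hc _), cfc_mul _ _ σ (hc _) (hc _), cfc_id' ℝ σ]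
  rw [h]
  simp only [mul_inv_mul_cancel]
  exact cfc_id' ℝ σ

theorem exists_pauliTensor_phase (v w : PauliVec n) : ∃ ω : ℂ, ω * star ω = 1 ∧
    pauliTensor v * pauliTensor w = ω • pauliTensor (v + w) ∧
    pauliTensor w * pauliTensor v = star ω • pauliTensor (v + w) ∧
    pauliTensor v = ω • (pauliTensor (v + w) * pauliTensor w) ∧
    pauliTensor v = star ω • (pauliTensor w * pauliTensor (v + w)) := by
  obtain ⟨c, hc⟩ := pauliTensor_mul v w
  have h2 : pauliTensor w * pauliTensor v = star (Complex.I ^ c) • pauliTensor (v + w) := by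
    have := congrArg star hc
    rwa [star_mul, star_smul, pauliTensor_star, pauliTensor_star, pauliTensor_star] at this
  refine ⟨Complex.I ^ c, ?_, hc, h2, ?_, ?_⟩
  · rw [star_pow, ← mul_pow]; simp
  · rw [← smul_mul_assoc, ← hc, mul_assoc, pauliTensor_sq, mul_one]
  · rw [← mul_smul_comm, ← h2, ← mul_assoc, pauliTensor_sq, one_mul]

instance (T : Finset (Fin n)) : Fintype (pauliSupported T) := Fintype.ofFinite _

/-- The reduced density operator of the code on `T`, up to normalization. -/
def reducedState (p : QOp n) (T : Finset (Fin n)) : QOp n :=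
  ∑ v : pauliSupported T, codeExpectation p (pauliTensor v.1) • pauliTensor v.1

theorem reducedState_mem (p : QOp n) (T : Finset (Fin n)) : reducedState p T ∈ opsOn T :=
  Submodule.sum_mem _ fun v _ => Submodule.smul_mem _ _ (pauliTensor_mem_opsOn v.2)

theorem IsCodeProjection.reducedState_star {p : QOp n} (hp : IsCodeProjection p)
    (T : Finset (Fin n)) : star (reducedState p T) = reducedState p T := by
  simp only [reducedState, star_sum, star_smul, pauliTensor_star, ← hp.codeExpectation_star]

/-- The operator `reducedState p T` represents the expectation functional on `T`. -/
theorem sum_codeExpectation_mul_right (p : QOp n) {T : Finset (Fin n)} {x : QOp n}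
    (hx : x ∈ opsOn T) :
    ∑ v : pauliSupported T, codeExpectation p (pauliTensor v.1 * x) • pauliTensor v.1 =
      x * reducedState p T := by
  refine opsOn_induction (q := fun x => ∑ v : pauliSupported T,
    codeExpectation p (pauliTensor v.1 * x) • pauliTensor v.1 = x * reducedState p T)
    (fun w hw => ?_) (by simp) ?_ ?_ hx
  · rw [reducedState, Finset.mul_sum]
    refine Fintype.sum_equiv (Equiv.addRight ⟨w, hw⟩) _ _ fun v => ?_
    obtain ⟨ω, hω, h1, h2, h3, h4⟩ := exists_pauliTensor_phase v.1 w
    change _ = pauliTensor w * codeExpectation p (pauliTensor (v.1 + w)) • pauliTensor (v.1 + w)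
    conv_lhs => rw [h1, map_smul, smul_eq_mul]; arg 2; rw [h4]
    rw [smul_smul, mul_smul_comm, mul_right_comm, hω, one_mul]
  · intro X Y hX hY
    simp only [mul_add, map_add, add_smul, Finset.sum_add_distrib, hX, hY, add_mul]
  · intro c X hX
    simp only [mul_smul_comm, map_smul, smul_assoc, ← Finset.smul_sum, hX, smul_mul_assoc]

/-- The partial trace over the qubits in `T`, as a sum over Pauli operators, gives operators on the
complement of `T`. -/
theorem sum_pauliTensor_conj_mem (T : Finset (Fin n)) (Y : QOp n) :
    ∑ v : pauliSupported T, pauliTensor v.1 * Y * pauliTensor v.1 ∈ opsOn Tᶜ := by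
  refine mem_opsOn_compl fun q hq t => ?_
  set w : PauliVec n := Pi.single q t with hwdef
  have hw : w ∈ pauliSupported T := fun j hj => by
    rw [hwdef, Pi.single_eq_of_ne]
    rintro rfl
    exact hj hq
  rw [commute_iff_eq, Finset.sum_mul, Finset.mul_sum]
  symm
  refine Fintype.sum_equiv (Equiv.addRight ⟨w, hw⟩) _ _ fun v => ?_
  obtain ⟨ω, hω, h1, h2, h3, h4⟩ := exists_pauliTensor_phase v.1 w
  change _ = pauliTensor (v.1 + w) * Y * pauliTensor (v.1 + w) * pauliTensor w
  calc pauliTensor w * (pauliTensor v.1 * Y * pauliTensor v.1)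
      = (pauliTensor w * pauliTensor v.1) * Y * pauliTensor v.1 := by simp only [mul_assoc]
    _ = star ω • pauliTensor (v.1 + w) * Y * (ω • (pauliTensor (v.1 + w) * pauliTensor w)) := by
        rw [h2, ← h3]
    _ = _ := by
        rw [smul_mul_assoc, smul_mul_assoc, mul_smul_comm, smul_smul, mul_comm (star ω), hω,
          one_smul]
        simp only [mul_assoc]

/-- Recovery from the erasure of `T`: if `T` satisfies the Knill–Laflamme condition, then every
logical operator has a representative on the complement of `T`, which moreover preserves the code
space.  It is the partial trace over `T` of `s L`, where `s` is a pseudoinverse of the reduced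
density operator on `T`. -/
theorem IsCodeProjection.exists_recovery {p : QOp n} (hp : IsCodeProjection p)
    {T : Finset (Fin n)} (hT : KnillLaflamme p T) {L : QOp n} (hpL : p * L = L) (hLp : L * p = L) :
    ∃ O ∈ opsOn Tᶜ, O * p = L ∧ p * O = L := by
  set σ := reducedState p T with hσ
  have hσT : σ ∈ opsOn T := reducedState_mem p T
  obtain ⟨s, hs, hcomm⟩ := exists_pseudoinverse (σ := σ) (hp.reducedState_star T)
  have hσs : Commute σ s := hcomm σ (Commute.refl σ)
  have hsT : s ∈ opsOn T := by
    rw [← compl_compl T]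
    refine mem_opsOn_compl fun q hq t => (hcomm _ ?_).symm
    refine commute_of_mem_opsOn (A := Tᶜ) (B := T) disjoint_compl_left ?_ hσT
    refine pauliTensor_mem_opsOn fun j hj => ?_
    rw [Pi.single_eq_of_ne]
    rintro rfl
    exact hj hq
  set r := 1 - σ * s with hr
  have hrT : r ∈ opsOn T := sub_mem (one_mem_opsOn T) (mul_mem_opsOn hσT hsT)
  have hrσ : r * σ = 0 := by rw [hr, sub_mul, one_mul, hs, sub_self]
  have hσr : σ * r = 0 := by
    rw [hr, mul_sub, mul_one, hσs.eq, ← mul_assoc, hs, sub_self]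
  -- the state `σ` sees no operator that it annihilates
  have hzero : ∀ x ∈ opsOn T, x * σ = 0 → codeExpectation p x = 0 := by
    intro x hx h0
    have h := sum_codeExpectation_mul_right p hx
    rw [← hσ, h0] at h
    have hli : LinearIndependent ℂ fun v : pauliSupported T => pauliTensor v.1 :=
      linearIndependent_pauliTensor.comp _ Subtype.val_injective
    have := Fintype.linearIndependent_iff.1 hli _ h 0
    simpa [pauliTensor_zero] using this
  have hrp : r * p = 0 := by
    refine eq_zero_of_star_mul_self ?_
    have hmem := mul_mem_opsOn (star_mem_opsOn hrT) hrT
    have h0 := hzero _ hmem (by rw [mul_assoc, hrσ, mul_zero])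
    have := hp.compress_eq hT hmem
    rw [h0, zero_smul] at this
    rw [star_mul, hp.star_eq, ← this]
    simp only [mul_assoc]
  have hpr : p * r = 0 := by
    rw [← star_eq_zero]
    refine eq_zero_of_star_mul_self ?_
    have hmem := mul_mem_opsOn hrT (star_mem_opsOn hrT)
    have hσ' : star r * σ = 0 := by
      have := congrArg star hσr
      rwa [star_mul, star_zero, hσ, hp.reducedState_star T] at this
    have h0 := hzero _ hmem (by rw [mul_assoc, hσ', mul_zero])
    have := hp.compress_eq hT hmem
    rw [h0, zero_smul] at this
    rw [star_star, star_mul, hp.star_eq, ← this]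
    simp only [mul_assoc]
  refine ⟨∑ v : pauliSupported T, pauliTensor v.1 * (s * L) * pauliTensor v.1,
    sum_pauliTensor_conj_mem T _, ?_, ?_⟩
  · have hterm : ∀ v : pauliSupported T, pauliTensor v.1 * (s * L) * pauliTensor v.1 * p =
        (codeExpectation p (pauliTensor v.1) • pauliTensor v.1) * (s * L) := by
      intro v
      calc pauliTensor v.1 * (s * L) * pauliTensor v.1 * p
          = pauliTensor v.1 * (s * L) * (p * pauliTensor v.1 * p) := by
            conv_lhs => rw [← hLp]
            simp only [mul_assoc]
        _ = _ := by
            rw [hp.compress_eq hT (pauliTensor_mem_opsOn v.2), mul_smul_comm, smul_mul_assoc,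
              mul_assoc, mul_assoc, hLp]
    rw [Finset.sum_mul, Finset.sum_congr rfl fun v _ => hterm v, ← Finset.sum_mul]
    change σ * (s * L) = L
    have h1 : σ * s = 1 - r := by rw [hr]; abel
    have h2 : r * L = 0 := by rw [← hpL, ← mul_assoc, hrp, zero_mul]
    rw [← mul_assoc, h1, sub_mul, one_mul, h2, sub_zero]
  · have hterm : ∀ v : pauliSupported T, p * (pauliTensor v.1 * (s * L) * pauliTensor v.1) =
        L * (codeExpectation p (pauliTensor v.1 * s) • pauliTensor v.1) := by
      intro v
      calc p * (pauliTensor v.1 * (s * L) * pauliTensor v.1)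
          = (p * (pauliTensor v.1 * s) * p) * L * pauliTensor v.1 := by
            conv_lhs => rw [← hpL]
            simp only [mul_assoc]
        _ = _ := by
            rw [hp.compress_eq hT (mul_mem_opsOn (pauliTensor_mem_opsOn v.2) hsT), smul_mul_assoc,
              smul_mul_assoc, hpL, mul_smul_comm]
    rw [Finset.mul_sum, Finset.sum_congr rfl fun v _ => hterm v, ← Finset.mul_sum,
      sum_codeExpectation_mul_right p hsT, ← hσ, ← hσs.eq]
    have h1 : σ * s = 1 - r := by rw [hr]; abel
    have h2 : L * r = 0 := by rw [← hLp, mul_assoc, hpr, mul_zero]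
    rw [h1, mul_sub, mul_one, h2, sub_zero]

/-! ### Enlarging a correctable set -/

/-- Let `O = ∑ a i * b i` represent the logical operator `L`, with `a i` on a correctable set that
is decoupled from the support of the `b i`.  Then the average `Q = ∑ ⟨a i⟩ b i` represents `L` as
well.  Decoupling gives `p O p = p Q p` and `p O* Q p = p Q* Q p`; hence `L* L`, `L* (Q p)` and
`(Q p)* (Q p)` coincide, and `(L - Q p)* (L - Q p) = 0`. -/
theorem IsCodeProjection.average_mul_eq {p : QOp n} (hp : IsCodeProjection p)
    {W V : Finset (Fin n)} (hWV : Disjoint W V) (hW : KnillLaflamme p W)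
    (hdec : ∀ a ∈ opsOn W, ∀ b ∈ opsOn V, p * (a * b) * p = p * a * p * b * p)
    {α : Type*} [Fintype α] {a b : α → QOp n} (ha : ∀ i, a i ∈ opsOn W) (hb : ∀ i, b i ∈ opsOn V)
    {L : QOp n} (hpL : p * L = L) (hO : (∑ i, a i * b i) * p = L) :
    (∑ i, codeExpectation p (a i) • b i) * p = L := by
  set O := ∑ i, a i * b i with hOdef
  set Q := ∑ i, codeExpectation p (a i) • b i with hQdef
  have hQ : Q ∈ opsOn V := Submodule.sum_mem _ fun i _ => Submodule.smul_mem _ _ (hb i)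
  have hdec' : ∀ x ∈ opsOn W, ∀ y ∈ opsOn V,
      p * (x * y) * p = codeExpectation p x • (p * y * p) := by
    intro x hx y hy
    rw [hdec x hx y hy, hp.compress_eq hW hx, smul_mul_assoc, smul_mul_assoc]
  have F1 : p * O * p = p * Q * p := by
    simp only [hOdef, hQdef, Finset.mul_sum, Finset.sum_mul, mul_smul_comm, smul_mul_assoc]
    exact Finset.sum_congr rfl fun i _ => hdec' _ (ha i) _ (hb i)
  have F2 : p * (star O * Q) * p = p * (star Q * Q) * p := by
    simp only [hOdef]
    conv_rhs => enter [1, 2, 1]; rw [hQdef]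
    simp only [star_sum, star_smul, Finset.mul_sum, Finset.sum_mul, mul_smul_comm, smul_mul_assoc]
    refine Finset.sum_congr rfl fun i _ => ?_
    have hcomm : star (a i * b i) = star (a i) * star (b i) := by
      rw [star_mul]
      exact (commute_of_mem_opsOn hWV (star_mem_opsOn (ha i)) (star_mem_opsOn (hb i))).symm.eq
    rw [hcomm, mul_assoc (star (a i)),
      hdec' _ (star_mem_opsOn (ha i)) _ (mul_mem_opsOn (star_mem_opsOn (hb i)) hQ),
      hp.codeExpectation_star]
  have hsO : p * star O = star L := by
    rw [← hO, star_mul, hp.star_eq]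
  have hLQ : star L * (Q * p) = star L * L := by
    have h1 : star L * p = star L := by
      have := congrArg star hpL
      rwa [star_mul, hp.star_eq] at this
    calc star L * (Q * p) = star L * p * (Q * p) := by rw [h1]
      _ = star L * (p * Q * p) := by simp only [mul_assoc]
      _ = star L * L := by rw [← F1, mul_assoc p, hO, hpL]
  have F3 : star L * (Q * p) = star (Q * p) * (Q * p) := by
    calc star L * (Q * p) = p * (star O * Q) * p := by rw [← hsO]; simp only [mul_assoc]
      _ = star (Q * p) * (Q * p) := by
        rw [F2, star_mul, hp.star_eq]; simp only [mul_assoc]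
  have F4 : star (Q * p) * L = star L * L := by
    have := congrArg star hLQ
    rwa [star_mul (star L), star_mul (star L), star_star] at this
  have hX : star (L - Q * p) * (L - Q * p) = 0 := by
    rw [star_sub, sub_mul, mul_sub, mul_sub, F4, ← F3, hLQ]
    abel
  exact (sub_eq_zero.1 (eq_zero_of_star_mul_self hX)).symm

/-- An operator that commutes with all logical operators is a scalar on the code space. -/
theorem IsCodeProjection.exists_smul_eq {p : QOp n} (hp : IsCodeProjection p) {M : QOp n}
    (hpM : p * M = M) (hMp : M * p = M) (h : ∀ Y, M * (p * Y * p) = p * Y * p * M) :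
    ∃ c : ℂ, M = c • p := by
  have h' : ∀ Y, M * Y * p = p * Y * M := by
    intro Y
    have := h Y
    calc M * Y * p = (M * p) * Y * p := by rw [hMp]
      _ = M * (p * Y * p) := by simp only [mul_assoc]
      _ = p * Y * (p * M) := by rw [this]; simp only [mul_assoc]
      _ = p * Y * M := by rw [hpM]
  obtain ⟨j, b, hjb⟩ : ∃ j b, p j b ≠ 0 := by
    by_contra hcon
    push Not at hcon
    exact hp.ne_zero (by ext j b; exact hcon j b)
  refine ⟨M j b / p j b, ?_⟩
  ext a i
  have := congrFun (congrFun (h' (Matrix.single i j 1)) a) b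
  simp [Matrix.mul_apply, Matrix.single_apply, ite_and] at this
  rw [Matrix.smul_apply, smul_eq_mul, div_mul_eq_mul_div, eq_div_iff hjb, this, mul_comm]

/-- A correctable set `W` may be enlarged by a correctable set `T` that separates it from the other
qubits.  By recovery from the erasure of `T` a logical operator has a representative off `T`, which
by `average_mul_eq` can be moved off `W` too; so it commutes with all operators on `W ∪ T`. -/
theorem KnillLaflamme.union_of_boundary {p : QOp n} (hp : IsCodeProjection p)
    {W T : Finset (Fin n)} (hWT : Disjoint W T) (hW : KnillLaflamme p W) (hT : KnillLaflamme p T)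
    (hdec : ∀ a ∈ opsOn W, ∀ b ∈ opsOn (W ∪ T)ᶜ, p * (a * b) * p = p * a * p * b * p) :
    KnillLaflamme p (W ∪ T) := by
  intro M hM
  set V := (W ∪ T)ᶜ with hV
  have hWV : Disjoint W V := disjoint_compl_right.mono_left Finset.subset_union_left
  have hTc : Tᶜ = W ∪ V := by
    ext q
    have := fun h : q ∈ W => Finset.disjoint_left.1 hWT h
    simp only [hV, Finset.mem_compl, Finset.mem_union]
    tauto
  have hpp := hp.mul_self
  refine hp.exists_smul_eq (M := p * M * p) (by simp only [← mul_assoc, hpp])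
    (by simp only [mul_assoc, hpp]) fun Y => ?_
  set L := p * Y * p with hL
  have hpL : p * L = L := by simp only [hL, ← mul_assoc, hpp]
  have hLp : L * p = L := by simp only [hL, mul_assoc, hpp]
  obtain ⟨O, hO, hOp, hpO⟩ := hp.exists_recovery hT hpL hLp
  rw [hTc] at hO
  obtain ⟨a, b, ha, hb, hOsum⟩ := exists_sum_mul_of_mem_opsOn hWV hO
  set Q := ∑ v, codeExpectation p (a v) • b v with hQ
  have hQV : Q ∈ opsOn V := Submodule.sum_mem _ fun i _ => Submodule.smul_mem _ _ (hb i)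
  have hQp : Q * p = L := hp.average_mul_eq hWV hW hdec ha hb hpL (by rw [← hOsum, hOp])
  have hpQ : p * Q = L := by
    have h := hp.average_mul_eq hWV hW hdec (fun v => star_mem_opsOn (ha v))
      (fun v => star_mem_opsOn (hb v)) (L := star L) ?_ ?_
    · have h' := congrArg star h
      rw [star_mul, hp.star_eq, star_star] at h'
      rw [← h', hQ]
      simp [star_sum, star_smul, hp.codeExpectation_star]
    · have := congrArg star hLp
      rwa [star_mul, hp.star_eq] at this
    · have h1 : ∑ v, star (a v) * star (b v) = star O := by
        rw [hOsum, star_sum]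
        refine Finset.sum_congr rfl fun v _ => ?_
        rw [star_mul]
        exact (commute_of_mem_opsOn hWV (star_mem_opsOn (ha v)) (star_mem_opsOn (hb v))).eq
      rw [h1, ← hpO, star_mul, hp.star_eq]
  have hMQ : Commute M Q := commute_of_mem_opsOn (A := W ∪ T) (B := V) disjoint_compl_right hM hQV
  calc p * M * p * L = p * M * (Q * p) := by rw [mul_assoc (p * M), hpL, hQp]
    _ = p * (M * Q) * p := by simp only [mul_assoc]
    _ = (p * Q) * M * p := by rw [hMQ.eq]; simp only [mul_assoc]
    _ = L * p * M * p := by rw [hpQ, hLp]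
    _ = L * (p * M * p) := by simp only [mul_assoc]

end

noncomputable section

namespace CommutingProjectorCode

variable {n m : ℕ} (C : CommutingProjectorCode n m)

/-! ### Correctable sets of a commuting projector code -/

/-- The product of the projections with indices in a list. -/
def projProd (l : List (Fin m)) : QOp n := (l.map C.proj).prod

theorem commute_projProd {l : List (Fin m)} {M : QOp n} (h : ∀ i ∈ l, Commute M (C.proj i)) :
    Commute M (C.projProd l) :=
  Commute.list_prod_right _ _ fun x hx => by
    obtain ⟨i, hi, rfl⟩ := List.mem_map.1 hx
    exact h i hi

theorem commute_projProd_projProd (l l' : List (Fin m)) :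
    Commute (C.projProd l) (C.projProd l') :=
  C.commute_projProd fun _ _ => (C.commute_projProd fun _ _ => C.proj_comm _ _).symm

theorem projProd_cons (i : Fin m) (l : List (Fin m)) :
    C.projProd (i :: l) = C.proj i * C.projProd l := by simp [projProd]

theorem proj_mul_projProd {l : List (Fin m)} {i : Fin m} (hi : i ∈ l) :
    C.proj i * C.projProd l = C.projProd l := by
  induction l with
  | nil => simp at hi
  | cons j l ih =>
    rw [projProd_cons]
    rcases List.mem_cons.1 hi with rfl | h
    · rw [← mul_assoc, C.proj_idem]
    · rw [← mul_assoc, (C.proj_comm i j).eq, mul_assoc, ih h]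

theorem projProd_mul_of_forall {l : List (Fin m)} {X : QOp n}
    (h : ∀ i ∈ l, C.proj i * X = X) : C.projProd l * X = X := by
  induction l with
  | nil => simp [projProd]
  | cons j l ih =>
    rw [projProd_cons, mul_assoc, ih fun i hi => h i (List.mem_cons_of_mem _ hi),
      h j List.mem_cons_self]

theorem projProd_mul_self (l : List (Fin m)) : C.projProd l * C.projProd l = C.projProd l :=
  C.projProd_mul_of_forall fun _ => C.proj_mul_projProd

theorem star_projProd (l : List (Fin m)) : star (C.projProd l) = C.projProd l := by
  induction l with
  | nil => simp [projProd]
  | cons j l ih =>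
    have hj : star (C.proj j) = C.proj j := C.proj_hermitian j
    rw [projProd_cons, star_mul, ih, hj]
    exact ((C.commute_projProd fun i _ => C.proj_comm j i).eq).symm

/-- The orthogonal projection onto the code space. -/
def projection : QOp n := C.projProd (List.finRange m)

theorem proj_mul_projection (i : Fin m) : C.proj i * C.projection = C.projection :=
  C.proj_mul_projProd (List.mem_finRange i)

theorem projection_mul_self : C.projection * C.projection = C.projection := C.projProd_mul_self _

theorem star_projection : star C.projection = C.projection := C.star_projProd _

theorem projection_eq_mul (q : Fin m → Prop) [DecidablePred q] :
    C.projection = C.projProd ((List.finRange m).filter q) *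
      C.projProd ((List.finRange m).filter (¬ q ·)) := by
  set P₁ := C.projProd ((List.finRange m).filter q)
  set P₂ := C.projProd ((List.finRange m).filter (¬ q ·))
  have hc : Commute P₁ P₂ := C.commute_projProd_projProd _ _
  have h1 : C.projection * (P₁ * P₂) = P₁ * P₂ := by
    refine C.projProd_mul_of_forall fun i _ => ?_
    by_cases hi : q i
    · rw [← mul_assoc, C.proj_mul_projProd (by simp [hi])]
    · rw [hc.eq, ← mul_assoc, C.proj_mul_projProd (by simp [hi])]
  have h2 : P₁ * P₂ * C.projection = C.projection := by
    rw [mul_assoc, C.projProd_mul_of_forall (X := C.projection) fun i _ => C.proj_mul_projection i,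
      C.projProd_mul_of_forall fun i _ => C.proj_mul_projection i]
  have h3 := congrArg star h1
  rw [star_mul, C.star_projection, star_mul, C.star_projProd, C.star_projProd, ← hc.eq, h2] at h3
  exact h3

theorem mem_codeSpace_iff {ψ : (Fin n → Fin 2) → ℂ} :
    ψ ∈ C.codeSpace ↔ C.projection.mulVec ψ = ψ := by
  constructor
  · intro h
    have key : ∀ l : List (Fin m), (C.projProd l).mulVec ψ = ψ := by
      intro l
      induction l with
      | nil => simp [projProd]
      | cons i l ih => rw [projProd_cons, ← Matrix.mulVec_mulVec, ih, h i]
    exact key _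
  · intro h i
    rw [← h, Matrix.mulVec_mulVec, C.proj_mul_projection]

theorem not_isLogicalError_iff {E : PauliOp n} : ¬ C.IsLogicalError E ↔
    ∃ c : ℂ, C.projection * E.toOp * C.projection = c • C.projection := by
  have hadj : ∀ x w : (Fin n → Fin 2) → ℂ,
      dotProduct (star (C.projection.mulVec x)) w =
        dotProduct (star x) (C.projection.mulVec w) := by
    intro x w
    rw [Matrix.star_mulVec, Matrix.dotProduct_mulVec, ← Matrix.star_eq_conjTranspose,
      C.star_projection]
  rw [IsLogicalError, not_not]
  refine exists_congr fun c => ⟨fun h => ?_, fun h φ hφ ψ hψ => ?_⟩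
  · ext i j
    have hmem : ∀ x, C.projection.mulVec x ∈ C.codeSpace := fun x => by
      rw [C.mem_codeSpace_iff, Matrix.mulVec_mulVec, C.projection_mul_self]
    have := h _ (hmem (Pi.single i 1)) _ (hmem (Pi.single j 1))
    rw [hadj, hadj, Matrix.mulVec_mulVec, Matrix.mulVec_mulVec, Matrix.mulVec_mulVec,
      C.projection_mul_self] at this
    have hs : star (Pi.single i 1 : (Fin n → Fin 2) → ℂ) = Pi.single i 1 := by
      rw [← Pi.single_star, star_one]
    simpa [hs] using this
  · rw [C.mem_codeSpace_iff] at hφ hψ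
    rw [← hφ, ← hψ, hadj, hadj, Matrix.mulVec_mulVec, Matrix.mulVec_mulVec, Matrix.mulVec_mulVec,
      h, C.projection_mul_self, Matrix.smul_mulVec, dotProduct_smul, smul_eq_mul]

/-- For two sets of qubits without interactions between them, the compression of a product of local
operators to the code space is the product of the compressions. -/
theorem compress_mul_of_decoupled {U V : Finset (Fin n)} (hUV : Disjoint U V)
    (hadj : ∀ u ∈ U, ∀ v ∈ V, ¬ Interacts (Set.range C.proj) u v) :
    ∀ a ∈ opsOn U, ∀ b ∈ opsOn V, C.projection * (a * b) * C.projection =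
      C.projection * a * C.projection * b * C.projection := by
  classical
  intro a ha b hb
  -- split the projections into those that meet `U` and those that do not
  have hprod := C.projection_eq_mul fun i => ∃ u ∈ U, u ∈ opSupport (C.proj i)
  set P₁ := C.projProd ((List.finRange m).filter fun i => ∃ u ∈ U, u ∈ opSupport (C.proj i))
  set P₂ := C.projProd ((List.finRange m).filter fun i => ¬ ∃ u ∈ U, u ∈ opSupport (C.proj i))
  have h12 : P₁ * P₂ = P₂ * P₁ := (C.commute_projProd_projProd _ _).eq
  have hqq : P₂ * (P₁ * P₂) * P₁ = P₁ * P₂ := by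
    have h := C.projection_mul_self
    rw [hprod] at h
    rw [← mul_assoc, mul_assoc (P₂ * P₁), ← h12, h]
  have ha2 : a * P₂ = P₂ * a := by
    refine (C.commute_projProd fun i hi => ?_).eq
    simp only [List.mem_filter, decide_eq_true_eq] at hi
    have : C.proj i ∈ opsOn Uᶜ := mem_opsOn_compl_of_opSupport fun u hu hui => hi.2 ⟨u, hu, hui⟩
    exact commute_of_mem_opsOn disjoint_compl_right ha this
  have hb1 : b * P₁ = P₁ * b := by
    refine (C.commute_projProd fun i hi => ?_).eq
    simp only [List.mem_filter, decide_eq_true_eq] at hi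
    obtain ⟨-, u, hu, hui⟩ := hi
    have : C.proj i ∈ opsOn Vᶜ := mem_opsOn_compl_of_opSupport fun v hv hvi =>
      hadj u hu v hv ⟨fun h => Finset.disjoint_left.1 hUV hu (h ▸ hv), _, ⟨i, rfl⟩, hui, hvi⟩
    exact commute_of_mem_opsOn disjoint_compl_right hb this
  rw [hprod]
  calc P₁ * P₂ * (a * b) * (P₁ * P₂)
      = P₁ * (P₂ * a) * (b * P₁) * P₂ := by simp only [mul_assoc]
    _ = P₁ * (a * P₂) * (P₁ * b) * P₂ := by rw [← ha2, hb1]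
    _ = P₁ * a * (P₂ * P₁) * b * P₂ := by simp only [mul_assoc]
    _ = P₁ * a * (P₂ * (P₁ * P₂) * P₁) * b * P₂ := by rw [hqq, h12]
    _ = P₁ * (a * P₂) * (P₁ * P₂) * (P₁ * b) * P₂ := by simp only [mul_assoc]
    _ = P₁ * (P₂ * a) * (P₁ * P₂) * (b * P₁) * P₂ := by rw [ha2, hb1]
    _ = P₁ * P₂ * a * (P₁ * P₂) * b * (P₁ * P₂) := by simp only [mul_assoc]

theorem HasDistance.isCodeProjection {C : CommutingProjectorCode n m} {d : ℕ}
    (hd : C.HasDistance d) : IsCodeProjection C.projection where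
  star_eq := C.star_projection
  mul_self := C.projection_mul_self
  ne_zero h := by
    obtain ⟨E, hE, -⟩ := hd.1
    exact C.not_isLogicalError_iff.2 ⟨0, by simp [h]⟩ hE

theorem knillLaflamme_of_card_lt {d : ℕ} (hd : C.HasDistance d) {A : Finset (Fin n)}
    (hA : A.card < d) : KnillLaflamme C.projection A := by
  refine KnillLaflamme.of_pauliTensor fun v hv => ?_
  obtain ⟨P, rfl, hP⟩ := PauliOp.exists_vec_eq v
  rw [← hP]
  refine C.not_isLogicalError_iff.1 fun hE => ?_
  have h := hd.2 ⟨P, hE, rfl⟩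
  have hsub : {q | P.vec q ≠ 0} ⊆ (A : Set (Fin n)) := fun q hq => by
    by_contra hqA
    exact hq (hv q hqA)
  have := Set.ncard_le_ncard hsub
  rw [Set.ncard_coe_finset, ← PauliOp.weight_eq] at this
  omega

theorem HasDistance.not_knillLaflamme {C : CommutingProjectorCode n m} {d : ℕ}
    (hd : C.HasDistance d) {A : Finset (Fin n)}
    (hA : ∀ E : PauliOp n, E.weight = d → opSupport E.toOp ⊆ A) :
    ¬ KnillLaflamme C.projection A := by
  intro h
  obtain ⟨E, hE, hw⟩ := hd.1
  refine C.not_isLogicalError_iff.2 (h _ ?_) hE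
  obtain ⟨c, hc⟩ := E.toOp_eq
  rw [hc]
  refine Submodule.smul_mem _ _ (pauliTensor_mem_opsOn fun q hq => ?_)
  have := hA E hw
  rw [PauliOp.opSupport_toOp] at this
  by_contra hne
  exact hq (this hne)

theorem HasDistance.pos {C : CommutingProjectorCode n m} {d : ℕ} (hd : C.HasDistance d) :
    0 < d := by
  rw [Nat.pos_iff_ne_zero]
  rintro rfl
  refine hd.not_knillLaflamme (A := ∅) (fun E hE => ?_) (KnillLaflamme.of_pauliTensor ?_)
  · rw [PauliOp.weight, Set.ncard_eq_zero] at hE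
    simp [hE]
  · intro v hv
    have : v = 0 := funext fun q => hv q (by simp)
    exact ⟨1, by rw [this, pauliTensor_zero, mul_one, C.projection_mul_self, one_smul]⟩

theorem HasDistance.le {C : CommutingProjectorCode n m} {d : ℕ} (hd : C.HasDistance d) :
    d ≤ n := by
  obtain ⟨P, -, hw⟩ := hd.1
  rw [← hw, PauliOp.weight]
  exact (Set.ncard_le_card _).trans_eq (by simp)

/-- The correctable sets of a commuting projector code. -/
def correctableSets {d : ℕ} (hd : C.HasDistance d) :
    CorrectableSets (Interacts (Set.range C.proj)) d where
  Bare := KnillLaflamme C.projection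
  Dressed := KnillLaflamme C.projection
  pos := hd.pos
  bare_mono := KnillLaflamme.mono
  bare_of_dressed h := h
  dressed_of_card_lt := C.knillLaflamme_of_card_lt hd
  bare_union hA hB hAB hadj := hA.union hAB (C.compress_mul_of_decoupled hAB hadj) hB
  dressed_union hW hT hWT hadj := by
    refine hW.union_of_boundary hd.isCodeProjection hWT hT ?_
    refine C.compress_mul_of_decoupled
      (disjoint_compl_right.mono_left Finset.subset_union_left) fun w hw v hv => ?_
    exact hadj w hw v (Finset.mem_compl.1 hv)

end CommutingProjectorCode

/-! ### The bounds -/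

/-- If the complement of fewer than `d` qubits is `Bare`, then the set of all qubits is
`Dressed`. -/
theorem CorrectableSets.dressed_univ {V : Type*} [Fintype V] [DecidableEq V] {adj : V → V → Prop}
    {d : ℕ} (C : CorrectableSets adj d) {B : Finset V} (hB : C.Bare Bᶜ) (hd : B.card < d) :
    C.Dressed Finset.univ := by
  have h : Bᶜ ∪ B = Finset.univ := by rw [Finset.union_comm]; exact Finset.union_compl B
  rw [← h]
  refine C.dressed_union hB (C.dressed_of_card_lt hd) disjoint_compl_left fun w _ v hv => ?_
  rw [h] at hv
  exact absurd (Finset.mem_univ v) hv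

theorem one_le_lengthScale_dist {n d D : ℕ} (hD : 2 ≤ D) (hn : 0 < n)
    (h : (localityConst D)⁻¹ ^ 2 * (n : ℝ) ^ (((D : ℝ) - 1) / D) ≤ d) :
    1 ≤ localityConst D * ((d : ℝ) / (n : ℝ) ^ (((D : ℝ) - 1) / D)) := by
  have hn' : (0 : ℝ) < n := by exact_mod_cast hn
  have hc := localityConst_pos (D := D) (by omega)
  have hc1 : localityConst D ≤ 1 := localityConst_le_one (by omega)
  have h1 : (localityConst D)⁻¹ ^ 2 ≤ (d : ℝ) / (n : ℝ) ^ (((D : ℝ) - 1) / D) := by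
    rwa [le_div_iff₀ (by positivity)]
  have h2 : 1 ≤ (localityConst D)⁻¹ := (one_le_inv₀ hc).2 hc1
  calc (1 : ℝ) ≤ (localityConst D)⁻¹ := h2
    _ = localityConst D * (localityConst D)⁻¹ ^ 2 := by field_simp
    _ ≤ _ := by gcongr

theorem one_le_lengthScale_dim {n k d D : ℕ} (hD : 2 ≤ D) (hn : 0 < n)
    (h : (localityConst D)⁻¹ ^ 2 * (n : ℝ) ≤ k * (d : ℝ) ^ (1 / ((D : ℝ) - 1))) :
    1 ≤ localityConst D *
      ((k : ℝ) * (d : ℝ) ^ (1 / ((D : ℝ) - 1)) / n) ^ (((D : ℝ) - 1) / D) := by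
  have hn' : (0 : ℝ) < n := by exact_mod_cast hn
  have hc := localityConst_pos (D := D) (by omega)
  have hc1 : localityConst D ≤ 1 := localityConst_le_one (by omega)
  have hD' : (2 : ℝ) ≤ D := by exact_mod_cast hD
  have h1 : (localityConst D)⁻¹ ^ 2 ≤ (k : ℝ) * (d : ℝ) ^ (1 / ((D : ℝ) - 1)) / n := by
    rwa [le_div_iff₀ hn']
  have h2 : 1 ≤ (localityConst D)⁻¹ := (one_le_inv₀ hc).2 hc1
  -- the exponent `(D - 1) / D` is at least `1 / 2`
  have h3 : (localityConst D)⁻¹ ≤ ((localityConst D)⁻¹ ^ 2) ^ (((D : ℝ) - 1) / D) := by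
    rw [← Real.rpow_natCast, ← Real.rpow_mul (by positivity)]
    refine Real.self_le_rpow_of_one_le h2 ?_
    rw [← mul_div_assoc, le_div_iff₀ (by linarith)]
    push_cast
    linarith
  have h4 : (0 : ℝ) ≤ ((D : ℝ) - 1) / D := div_nonneg (by linarith) (by linarith)
  calc (1 : ℝ) = localityConst D * (localityConst D)⁻¹ := by field_simp
    _ ≤ localityConst D * ((localityConst D)⁻¹ ^ 2) ^ (((D : ℝ) - 1) / D) := by gcongr
    _ ≤ _ := by gcongr

theorem SubsystemCode.le_ncard_longInteractions {D n k g d m : ℕ} (hD : 2 ≤ D)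
    (C : SubsystemCode n k g) {G : Fin m → PauliOp n} {ι : Fin n → EuclideanSpace ℝ (Fin D)}
    (hk : 0 < k) (hd : C.HasDistance d) (hG : C.IsGaugeGenerators G) (hι : IsQubitEmbedding ι)
    (h : (localityConst D)⁻¹ ^ 2 * (n : ℝ) ≤ (k : ℝ) * (d : ℝ) ^ (1 / ((D : ℝ) - 1)) ∨
      (localityConst D)⁻¹ ^ 2 * (n : ℝ) ^ (((D : ℝ) - 1) / (D : ℝ)) ≤ (d : ℝ)) :
    localityConst D * max (k : ℝ) (d : ℝ) ≤
      ((longInteractions (Set.range fun i => (G i).toOp) ι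
        (localityConst D * max ((d : ℝ) / (n : ℝ) ^ (((D : ℝ) - 1) / (D : ℝ)))
          (((k : ℝ) * (d : ℝ) ^ (1 / ((D : ℝ) - 1)) / (n : ℝ)) ^
            (((D : ℝ) - 1) / (D : ℝ))))).ncard : ℝ) := by
  by_contra hcon
  push Not at hcon
  have hc := localityConst_pos (D := D) (by omega)
  have hkn : k ≤ n := by have := C.rank_add; omega
  have hn : 0 < n := hk.trans_le hkn
  set ℓ₁ : ℝ := (d : ℝ) / (n : ℝ) ^ (((D : ℝ) - 1) / (D : ℝ)) with hℓ₁
  set ℓ₂ : ℝ := ((k : ℝ) * (d : ℝ) ^ (1 / ((D : ℝ) - 1)) / (n : ℝ)) ^ (((D : ℝ) - 1) / (D : ℝ))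
    with hℓ₂
  have hℓ : 1 ≤ localityConst D * max ℓ₁ ℓ₂ := by
    rcases h with h | h
    · exact (one_le_lengthScale_dim hD hn h).trans (by gcongr; exact le_max_right _ _)
    · exact (one_le_lengthScale_dist hD hn h).trans (by gcongr; exact le_max_left _ _)
  have hpow : max ℓ₁ ℓ₂ ^ D * (n : ℝ) ^ (D - 1) ≤ d * ((max k d : ℕ) : ℝ) ^ (D - 1) := by
    rcases le_total ℓ₁ ℓ₂ with hle | hle
    · rw [max_eq_right hle, hℓ₂, pow_lengthScale_dim hD hn]
      gcongr
      exact le_max_left _ _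
    · rw [max_eq_left hle, hℓ₁, pow_lengthScale_dist hD hn]
      gcongr
      exact le_max_right _ _
  have hmax : max (k : ℝ) (d : ℝ) = ((max k d : ℕ) : ℝ) := (Nat.cast_max _ _).symm
  rw [hmax] at hcon
  obtain ⟨B, hB, hBK⟩ := exists_bare_compl_card_lt hD (C.correctableSets hd hG) hι hℓ
    (hk.trans_le (le_max_left k d)) (max_le hkn hd.le)
    (by rw [mul_pow, mul_assoc]; gcongr) hcon
  rcases lt_max_iff.1 hBK with hlt | hlt
  · have := C.dim_le_card_compl hB
    rw [compl_compl] at this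
    omega
  · have := C.dim_le_card_compl
      ((C.correctableSets hd hG).bare_of_dressed (CorrectableSets.dressed_univ _ hB hlt))
    simp at this
    omega

theorem CommutingProjectorCode.le_ncard_longInteractions {D n d m : ℕ} (hD : 2 ≤ D)
    (C : CommutingProjectorCode n m) {ι : Fin n → EuclideanSpace ℝ (Fin D)}
    (hd : C.HasDistance d) (hι : IsQubitEmbedding ι)
    (h : (localityConst D)⁻¹ ^ 2 * (n : ℝ) ^ (((D : ℝ) - 1) / (D : ℝ)) ≤ (d : ℝ)) :
    localityConst D * (d : ℝ) ≤
      ((longInteractions (Set.range C.proj) ι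
        (localityConst D * ((d : ℝ) / (n : ℝ) ^ (((D : ℝ) - 1) / (D : ℝ))))).ncard : ℝ) := by
  by_contra hcon
  push Not at hcon
  have hn : 0 < n := hd.pos.trans_le hd.le
  obtain ⟨B, hB, hBd⟩ := exists_bare_compl_card_lt hD (C.correctableSets hd) hι
    (one_le_lengthScale_dist hD hn h) hd.pos hd.le
    (by rw [mul_pow, mul_assoc, pow_lengthScale_dist hD hn]) hcon
  exact hd.not_knillLaflamme (fun E _ => by simp)
    (CorrectableSets.dressed_univ (C.correctableSets hd) hB hBd)

end

theorem theorem1 (D : ℕ) (hD : 2 ≤ D) :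
    ∃ c₀ c₁ : ℝ, 0 < c₀ ∧ 0 < c₁ ∧
      (∀ (n k g d m : ℕ) (C : SubsystemCode n k g) (G : Fin m → PauliOp n)
          (ι : Fin n → EuclideanSpace ℝ (Fin D)),
        0 < k → C.HasDistance d → C.IsGaugeGenerators G → IsQubitEmbedding ι →
        (c₁ * (n : ℝ) ≤ (k : ℝ) * (d : ℝ) ^ (1 / ((D : ℝ) - 1)) ∨
          c₁ * (n : ℝ) ^ (((D : ℝ) - 1) / (D : ℝ)) ≤ (d : ℝ)) →
        c₀ * max (k : ℝ) (d : ℝ) ≤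
          ((longInteractions (Set.range fun i => (G i).toOp) ι
            (c₀ * max ((d : ℝ) / (n : ℝ) ^ (((D : ℝ) - 1) / (D : ℝ)))
              (((k : ℝ) * (d : ℝ) ^ (1 / ((D : ℝ) - 1)) / (n : ℝ)) ^
                (((D : ℝ) - 1) / (D : ℝ))))).ncard : ℝ)) ∧
      (∀ (n d m : ℕ) (C : CommutingProjectorCode n m)
          (ι : Fin n → EuclideanSpace ℝ (Fin D)),
        0 < C.dimension → C.HasDistance d → IsQubitEmbedding ι →
        c₁ * (n : ℝ) ^ (((D : ℝ) - 1) / (D : ℝ)) ≤ (d : ℝ) →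
        c₀ * (d : ℝ) ≤
          ((longInteractions (Set.range C.proj) ι
            (c₀ * ((d : ℝ) / (n : ℝ) ^ (((D : ℝ) - 1) / (D : ℝ))))).ncard : ℝ)) := by
  have hc := localityConst_pos (D := D) (by omega)
  refine ⟨localityConst D, (localityConst D)⁻¹ ^ 2, hc, by positivity, ?_, ?_⟩
  · intro n k g d m C G ι hk hd hG hι h
    exact C.le_ncard_longInteractions hD hk hd hG hι h
  · intro n d m C ι _ hd hι h
    exact C.le_ncard_longInteractions hD hd hι h
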